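/- Let $0<f<1$. A \emph{valid function} for $R_f(\mathbb R,\mathbb Z)$ is a function $\pi\colon\mathbb R\to\mathbb R$ with $\pi\ge 0$ and $\sum_{r}\pi(r)y(r)\ge 1$ for every finitely supported $y\colon\mathbb R\to\mathbb Z_{\ge 0}$ with $\sum_r r\,y(r)\in f+\mathbb Z$. A valid function $\pi$ is \emph{extreme} if $\pi=\frac12(\pi^1+\pi^2)$ with $\pi^1,\pi^2$ valid implies $\pi^1=\pi^2=\pi$. Given real parameters $f,d_1,d_2,a_0,\delta_1,\delta_2$ with $0<f<1$, $d_1,d_2,a_0,\delta_1,\delta_2>0$ and $d_1+d_2<f$, put $$d_3=f-d_1-d_2,\quad c_2=0,\quad c_3=-\tfrac1{1-f},\quad c_1=\frac{1-d_3c_3}{d_1},$$ $$d_{21}=\tfrac{d_2}2,\quad d_{31}=\tfrac{c_1}{c_1-c_3}d_{21},\quad d_{11}=a_0-d_{31},\quad d_{13}=a_0-d_{21},\quad d_{12}=\tfrac{d_1-d_{13}}2-d_{11},\quad d_{32}=\tfrac{d_3}2-d_{31},$$ $$\delta_i^-=\tfrac{c_1}{c_1-c_3}\delta_i,\quad \delta_i^+=\delta_i-\delta_i^-\quad(i=1,2).$$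 Let $L$ be the list of (length, slope) pairs $$(d_{11},c_1),(d_{31},c_3),(\delta_1^+,c_1),(\delta_1^-,c_3),(\delta_2^+,c_1),(\delta_2^-,c_3),(d_{12}-\delta_1^+-\delta_2^+,c_1),(d_{32}-\delta_1^--\delta_2^-,c_3),(d_{21},c_2).$$ Consider the list consisting of $L$, then $(d_{13},c_1)$, then $L$ in reverse order, then $(1-f,c_3)$; its lengths sum to $1$. If all of its lengths are positive, the function \emph{of type \texttt{bhk\_irrational} with peak $f$} with these parameters is the $\mathbb Z$-periodic function that has value $0$ at $0$ and that on $[0,1]$ is continuous and affine on successive intervals with the listed lengths and slopes. \textbf{Proposition.} There are $f\in(0,1)$, a sequence $(\pi_n)_{n\in\mathbb N}$ of continuous functions of type \texttt{bhk\_irrational} with peak $f$ that are extreme for $R_f(\mathbb R,\mathbb Z)$, and a continuous function $\pi$ of type \texttt{bhk\_irrational} with peak $f$ that is valid but not extreme for $R_f(\mathbb R,\mathbb Z)$, such that $\pi_n\to\pi$ uniformly on $\mathbb R$. Moreover, these functions have locally integrable generalized (weak) derivatives, the generalized derivatives of $\pi_n$ converge to that of $\pi$ in $L^1_{\mathrm{loc}}(\mathbb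 R)$, and hence $\pi_n\to\pi$ in $W^{1,1}_{\mathrm{loc}}(\mathbb R)$. -/

import Mathlib

open MeasureTheory Filter Topology
open scoped ContDiff

noncomputable section

namespace GroupRelax

/-! ## The single-row infinite group problem -/

/-- `R_f(ℝ, ℤ)`: finitely supported functions `y : ℝ → ℤ₊` with `∑ r, r * y r ∈ f + ℤ`. -/
def feasible (f : ℝ) : Set (ℝ →₀ ℕ) :=
  {y | ∃ m : ℤ, y.sum (fun r k => r * (k : ℝ)) = f + m}

/-- Valid functions for `R_f(ℝ, ℤ)`. -/
def IsValid (f : ℝ) (π : ℝ → ℝ) : Prop :=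
  (∀ r, 0 ≤ π r) ∧ ∀ y ∈ feasible f, 1 ≤ y.sum (fun r k => π r * (k : ℝ))

/-- Extreme functions for `R_f(ℝ, ℤ)`. -/
def IsExtreme (f : ℝ) (π : ℝ → ℝ) : Prop :=
  IsValid f π ∧ ∀ π₁ π₂ : ℝ → ℝ, IsValid f π₁ → IsValid f π₂ →
    (∀ x, π x = (π₁ x + π₂ x) / 2) → π₁ = π ∧ π₂ = π

/-! ## Piecewise linear functions from interval lengths and slopes -/

/-- The continuous piecewise linear function starting with value `0` at `0` which has, on
successive intervals of lengths `s.1`, the slopes `s.2`, for `s` in the given list.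
(It is only used between `0` and the total length.) -/
def plFun : List (ℝ × ℝ) → ℝ → ℝ
  | [], _ => 0
  | s :: L, x => if x ≤ s.1 then s.2 * x else s.2 * s.1 + plFun L (x - s.1)

/-! ## The family `bhk_irrational` -/

/-- The parameters of a function of type `bhk_irrational`: the peak `f`, the total length `d1` of
the intervals of slope `c1` and `d2` of the intervals of slope `c2` between `0` and `f`, the end
`a0` of the first rise and fall, and the lengths `δ1`, `δ2` of two zigzags. -/
structure BHKParams where
  f : ℝ
  d1 : ℝ
  d2 : ℝ
  a0 : ℝ
  δ1 : ℝ
  δ2 : ℝ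

namespace BHKParams

variable (p : BHKParams)

/-- Total length of the intervals of slope `c3` between `0` and `f`. -/
def d3 : ℝ := p.f - p.d1 - p.d2

/-- The middle slope. -/
def c2 (_p : BHKParams) : ℝ := 0

/-- The negative slope. -/
def c3 : ℝ := -1 / (1 - p.f)

/-- The positive slope; `c1 * d1 + c2 * d2 + c3 * d3 = 1`, so that the value at `f` is `1`. -/
def c1 : ℝ := (1 - p.d2 * p.c2 - p.d3 * p.c3) / p.d1

def d21 : ℝ := p.d2 / 2
def d31 : ℝ := p.c1 / (p.c1 - p.c3) * p.d21
def d11 : ℝ := p.a0 - p.d31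
def d13 : ℝ := p.a0 - p.d21
def d12 : ℝ := (p.d1 - p.d13) / 2 - p.d11
def d32 : ℝ := p.d3 / 2 - p.d31

/-- A zigzag of length `δ` falls by slope `c3` on a length `zneg δ`, after a rise by slope `c1`
on the length `zpos δ`; the rise and the fall cancel. -/
def zneg (δ : ℝ) : ℝ := p.c1 * δ / (p.c1 - p.c3)
def zpos (δ : ℝ) : ℝ := δ - p.zneg δ

/-- Lengths and slopes of the intervals to the left of the central interval. -/
def left : List (ℝ × ℝ) :=
  [(p.d11, p.c1), (p.d31, p.c3),
   (p.zpos p.δ1, p.c1), (p.zneg p.δ1, p.c3),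
   (p.zpos p.δ2, p.c1), (p.zneg p.δ2, p.c3),
   (p.d12 - p.zpos p.δ1 - p.zpos p.δ2, p.c1),
   (p.d32 - p.zneg p.δ1 - p.zneg p.δ2, p.c3),
   (p.d21, p.c2)]

/-- Lengths and slopes of all intervals between `0` and `1`. -/
def segments : List (ℝ × ℝ) :=
  p.left ++ [(p.d13, p.c1)] ++ p.left.reverse ++ [(1 - p.f, p.c3)]

/-- The requirements on the parameters; in particular all the intervals are proper. -/
structure Admissible : Prop where
  f_pos : 0 < p.f
  f_lt_one : p.f < 1
  d1_pos : 0 < p.d1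
  d2_pos : 0 < p.d2
  d3_pos : p.d1 + p.d2 < p.f
  a0_pos : 0 < p.a0
  δ1_pos : 0 < p.δ1
  δ2_pos : 0 < p.δ2
  length_pos : ∀ s ∈ p.segments, 0 < s.1

/-- The `ℤ`-periodic function with the given parameters. -/
def toFun (x : ℝ) : ℝ := plFun p.segments (Int.fract x)

end BHKParams

/-- `π` is a function of type `bhk_irrational` with peak `f`. -/
def IsBHKIrrational (f : ℝ) (π : ℝ → ℝ) : Prop :=
  ∃ p : BHKParams, p.Admissible ∧ p.f = f ∧ π = p.toFun

/-! ## Generalized derivatives and convergence -/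

/-- `v` is a generalized (weak) derivative of `u` on `ℝ`, both locally integrable. -/
def HasWeakDeriv (u v : ℝ → ℝ) : Prop :=
  LocallyIntegrable u volume ∧ LocallyIntegrable v volume ∧
    ∀ φ : ℝ → ℝ, ContDiff ℝ ∞ φ → HasCompactSupport φ →
      ∫ x, u x * deriv φ x = -∫ x, v x * φ x

/-- Convergence in `L¹_loc(ℝ)`. -/
def TendstoL1Loc (u : ℕ → ℝ → ℝ) (w : ℝ → ℝ) : Prop :=
  (∀ n, LocallyIntegrable (u n) volume) ∧ LocallyIntegrable w volume ∧
    ∀ K : Set ℝ, IsCompact K → Tendsto (fun n => ∫ x in K, |u n x - w x|) atTop (𝓝 0)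

/-- Convergence in `W^{1,1}_loc(ℝ)`: convergence of the functions and of their generalized
derivatives in `L¹_loc(ℝ)`. -/
def TendstoW11Loc (u : ℕ → ℝ → ℝ) (w : ℝ → ℝ) : Prop :=
  ∃ (u' : ℕ → ℝ → ℝ) (w' : ℝ → ℝ), (∀ n, HasWeakDeriv (u n) (u' n)) ∧ HasWeakDeriv w w' ∧
    TendstoL1Loc u w ∧ TendstoL1Loc u' w'

end GroupRelax

end

/-! Fix `f = 4/5`, `d1 = 3/5`, `d2 = 1/10`, `a0 = 3/20`, and let two zigzags of lengths `t` and
`1/40 - t` share the interval `[3/20, 7/40]`, with `0 < t < 1/40`. The slopes are then `5/2`, `-5`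
and `0`, and only the split of the zigzags, together with its mirror image under `x ↦ 4/5 - x`,
depends on `t`. The limit function has `t = 1/80`; the sequence takes irrational `t` tending to
`1/80`.

The mechanism is this. At `3/20`, `3/20 + t` and `7/40` the function has the value `1/4`, and adding
one of these points to a point of the flat piece `[3/10, 7/20]` gives an additive pair as long as
the sum stays in the other flat piece `[9/20, 1/2]`. A function that is additive wherever `g` is
must therefore have, up to a linear term, both periods `t` and `1/40` on `[3/10, 7/20]`.

If `t` is irrational, `const_of_two_periods` makes it affine there. If `g` is the average of two
valid functions, then these are symmetric, hence subadditive and periodic, and they are additive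
wherever `g` is. Cauchy's equation on short intervals (`linear_of_additive_of_bounded`) gives them
constant rising and falling slopes, and the values at `4/5` and `2/5` determine these slopes
(`Shape.eq_of_additive`). So `g` is extreme.

If `t = 1/80`, the two periods are commensurable, and a small sine wave on the flat pieces can be
added with either sign without losing validity, so `g` is not extreme. Subadditivity is proved once,
by `Shape.subadditive`, for the perturbed and the unperturbed functions alike.

The breakpoints move continuously with `t`. This gives uniform convergence, and almost everywhere
the derivatives, which are bounded by `5`, are eventually equal to that of the limit; dominated
convergence does the rest. -/

namespace GroupRelax

/-! ## Valid functions, linearity and periods -/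

/-- A nonnegative periodic subadditive function with value `1` at the peak is valid. -/
theorem isValid_of_subadditive {f : ℝ} {g : ℝ → ℝ} (h0 : g 0 = 0) (hnn : ∀ x, 0 ≤ g x)
    (hsub : ∀ x y, g (x + y) ≤ g x + g y) (hper : Function.Periodic g 1) (hf : g f = 1) :
    IsValid f g := by
  refine ⟨hnn, ?_⟩
  rintro y ⟨m, hm⟩
  have hmul : ∀ (n : ℕ) (x : ℝ), g (x * n) ≤ g x * n := by
    intro n x
    induction n with
    | zero => simp [h0]
    | succ n ih =>
      have := hsub (x * n) x
      push_cast
      rw [mul_add, mul_add, mul_one, mul_one]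
      linarith
  have key : g (y.sum fun r k => r * (k : ℝ)) ≤ y.sum fun r k => g r * (k : ℝ) := by
    unfold Finsupp.sum
    refine (Finset.le_sum_of_subadditive g h0.le (fun a b => hsub a b) _ _).trans ?_
    exact Finset.sum_le_sum fun i _ => hmul _ _
  rw [hm] at key
  have h1 : g (f + m) = 1 := by
    have := hper.int_mul m f
    simp only [mul_one] at this
    rw [this, hf]
  linarith

theorem IsValid.one_le_pair {f : ℝ} {g : ℝ → ℝ} (hg : IsValid f g) {a b : ℝ} {m : ℤ}
    (h : a + b = f + m) : 1 ≤ g a + g b := by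
  have := hg.2 (Finsupp.single a 1 + Finsupp.single b 1) ⟨m, by
    rw [Finsupp.sum_add_index' (by simp) (by intros; push_cast; ring)]
    simpa using h⟩
  rw [Finsupp.sum_add_index' (by simp) (by intros; push_cast; ring)] at this
  simpa using this

theorem IsValid.one_le_triple {f : ℝ} {g : ℝ → ℝ} (hg : IsValid f g) {a b c : ℝ} {m : ℤ}
    (h : a + b + c = f + m) : 1 ≤ g a + g b + g c := by
  have := hg.2 (Finsupp.single a 1 + Finsupp.single b 1 + Finsupp.single c 1) ⟨m, by
    rw [Finsupp.sum_add_index' (by simp) (by intros; push_cast; ring),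
      Finsupp.sum_add_index' (by simp) (by intros; push_cast; ring)]
    simpa using h⟩
  rw [Finsupp.sum_add_index' (by simp) (by intros; push_cast; ring),
    Finsupp.sum_add_index' (by simp) (by intros; push_cast; ring)] at this
  simpa using this

/-! ### Averages of two valid functions -/

section Average

variable {f : ℝ} {π θ θ' : ℝ → ℝ}

/-- If a symmetric function is the average of two valid functions, these are symmetric. -/
theorem IsValid.symmetric_of_average (h : IsValid f θ) (h' : IsValid f θ')
    (hav : ∀ x, π x = (θ x + θ' x) / 2) (hsym : ∀ x, π x + π (f - x) = 1) (x : ℝ) :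
    θ x + θ (f - x) = 1 := by
  have e : x + (f - x) = f + ((0 : ℤ) : ℝ) := by push_cast; ring
  have h1 := h.one_le_pair e
  have h2 := h'.one_le_pair e
  have h3 := hsym x
  rw [hav, hav] at h3
  linarith

/-- Validity is applied to `x`, `y` and `f - (x + y)`; symmetry turns the third value into `1 - θ (x
+ y)`. -/
theorem IsValid.subadditive_of_symmetric (h : IsValid f θ) (hsym : ∀ x, θ x + θ (f - x) = 1)
    (x y : ℝ) : θ (x + y) ≤ θ x + θ y := by
  have e : x + y + (f - (x + y)) = f + ((0 : ℤ) : ℝ) := by push_cast; ring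
  have h1 := h.one_le_triple e
  have h2 := hsym (x + y)
  linarith

/-- The pairs `x + 1, f - x` and `x, f - (x + 1)` sum to `f + 1` and `f - 1`. With symmetry they
give the two inequalities between `θ (x + 1)` and `θ x`. -/
theorem IsValid.periodic_of_symmetric (h : IsValid f θ) (hsym : ∀ x, θ x + θ (f - x) = 1) :
    Function.Periodic θ 1 := by
  intro x
  have h1 := h.one_le_pair (a := x + 1) (b := f - x) (m := 1) (by push_cast; ring)
  have h2 := h.one_le_pair (a := x) (b := f - (x + 1)) (m := -1) (by push_cast; ring)
  have h3 := hsym x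
  have h4 := hsym (x + 1)
  linarith

/-- Two inequalities whose average is an equality are both equalities. -/
theorem additive_of_average (hs : ∀ x y, θ (x + y) ≤ θ x + θ y)
    (hs' : ∀ x y, θ' (x + y) ≤ θ' x + θ' y) (hav : ∀ x, π x = (θ x + θ' x) / 2) {x y : ℝ}
    (h : π x + π y = π (x + y)) : θ (x + y) = θ x + θ y := by
  have h1 := hs x y
  have h2 := hs' x y
  rw [hav, hav, hav] at h
  linarith

end Average

/-- A bounded function that is additive on the triangle over `[0, a]` is linear on `[0, a]`. -/
theorem linear_of_additive_of_bounded {φ : ℝ → ℝ} {a M : ℝ} (ha : 0 < a)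
    (hb : ∀ x, 0 ≤ x → x ≤ a → |φ x| ≤ M)
    (hadd : ∀ x y, 0 ≤ x → 0 ≤ y → x + y ≤ a → φ (x + y) = φ x + φ y) {x : ℝ}
    (hx0 : 0 ≤ x) (hxa : x ≤ a) : φ x = φ a / a * x := by
  -- The remainder is additive and vanishes at `a`, so `ψ (a - x) = -ψ x` and it suffices to bound
  -- `ψ` on the left half of the interval. There doubling the argument halves the bound, again and
  -- again.
  set ψ : ℝ → ℝ := fun x => φ x - φ a / a * x with hψ
  have hψadd : ∀ x y, 0 ≤ x → 0 ≤ y → x + y ≤ a → ψ (x + y) = ψ x + ψ y := by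
    intro x y h1 h2 h3
    simp only [hψ, hadd x y h1 h2 h3]
    ring
  have hψa : ψ a = 0 := by simp only [hψ]; field_simp; ring
  have hφa : |φ a| ≤ M := hb a ha.le le_rfl
  have hbound : ∀ n : ℕ, ∀ x, 0 ≤ x → x ≤ a → |ψ x| ≤ 2 * M / 2 ^ n := by
    intro n
    induction n with
    | zero =>
      intro x h0 h1
      have h2 : |φ a / a * x| ≤ M := by
        rw [abs_mul, abs_div, abs_of_pos ha, abs_of_nonneg h0, div_mul_eq_mul_div, div_le_iff₀ ha]
        exact mul_le_mul hφa h1 h0 ((abs_nonneg _).trans hφa)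
      have h3 := abs_sub (φ x) (φ a / a * x)
      have h4 := hb x h0 h1
      simp only [hψ, pow_zero, div_one]
      linarith
    | succ n ih =>
      have half : ∀ x, 0 ≤ x → x + x ≤ a → |ψ x| ≤ 2 * M / 2 ^ (n + 1) := by
        intro x h0 h1
        have h2 := ih (x + x) (by linarith) h1
        rw [hψadd x x h0 h0 h1, ← two_mul, abs_mul, abs_two] at h2
        rw [pow_succ, ← div_div]
        linarith
      intro x h0 h1
      rcases le_total (x + x) a with h | h
      · exact half x h0 h
      · have h2 := half (a - x) (by linarith) (by linarith)
        have h3 := hψadd x (a - x) h0 (by linarith) (by linarith)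
        rw [add_sub_cancel, hψa] at h3
        rwa [show ψ (a - x) = - ψ x by linarith, abs_neg] at h2
  have hlim : Tendsto (fun n : ℕ => 2 * M / 2 ^ n) atTop (𝓝 0) := by
    have := (tendsto_pow_atTop_nhds_zero_of_lt_one (r := (1 / 2 : ℝ)) (by norm_num)
      (by norm_num)).const_mul (2 * M)
    simpa [div_eq_mul_inv] using this
  have h0 : |ψ x| ≤ 0 := ge_of_tendsto' hlim fun n => hbound n x hx0 hxa
  have h1 : ψ x = 0 := abs_eq_zero.mp (le_antisymm h0 (abs_nonneg _))
  simp only [hψ] at h1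
  linarith

/-- A continuous function on an interval that has two incommensurable periods, whose sum is at
most the length of the interval, is constant. -/
theorem const_of_two_periods {ψ : ℝ → ℝ} {a b s t : ℝ} (hψ : Continuous ψ) (hs : 0 < s)
    (ht : 0 < t) (hst : a + s + t ≤ b) (hirr : Irrational (s / t))
    (hps : ∀ x, a ≤ x → x + s ≤ b → ψ (x + s) = ψ x)
    (hpt : ∀ x, a ≤ x → x + t ≤ b → ψ (x + t) = ψ x) {x y : ℝ} (hx : a ≤ x) (hxb : x ≤ b)
    (hy : a ≤ y) (hyb : y ≤ b) : ψ x = ψ y := by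
  -- `Ψ` is the `s`-periodic extension of `ψ` from `[a, a + s)` to the line. Since `a + s + t ≤ b`,
  -- a representative shifted by `t` stays in `[a, b]`, so `Ψ` also has period `t`, and its periods
  -- are dense.
  set Ψ : ℝ → ℝ := fun z => ψ (toIcoMod hs a z) with hΨ
  have hnat : ∀ (n : ℕ) (z : ℝ), a ≤ z → z + n * s ≤ b → ψ (z + n * s) = ψ z := by
    intro n
    induction n with
    | zero => intro z _ _; simp
    | succ n ih =>
      intro z h1 h2
      push_cast at h2 ⊢
      have h3 : 0 ≤ (n : ℝ) * s := by positivity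
      rw [show z + ((n : ℝ) + 1) * s = (z + n * s) + s by ring,
        hps _ (by linarith) (by linarith), ih z h1 (by linarith)]
  have hΨeq : ∀ z, a ≤ z → z ≤ b → Ψ z = ψ z := by
    intro z h1 h2
    have hmem := toIcoMod_mem_Ico hs a z
    have hk := toIcoMod_add_toIcoDiv_zsmul hs a z
    have hk0 : 0 ≤ toIcoDiv hs a z := by
      by_contra hneg
      have h4 : toIcoDiv hs a z ≤ -1 := by omega
      have h5 : (toIcoDiv hs a z : ℝ) ≤ -1 := by exact_mod_cast h4
      rw [zsmul_eq_mul] at hk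
      nlinarith [hmem.1, hmem.2]
    obtain ⟨n, hn⟩ := Int.eq_ofNat_of_zero_le hk0
    rw [hn, zsmul_eq_mul] at hk
    push_cast at hk
    have := hnat n (toIcoMod hs a z) hmem.1 (by linarith)
    rw [hk] at this
    exact this.symm
  have hΨs : ∀ z, Ψ (z + s) = Ψ z := fun z => by simp only [hΨ, toIcoMod_add_right]
  have hΨt : ∀ z, Ψ (z + t) = Ψ z := by
    intro z
    have hmem := toIcoMod_mem_Ico hs a z
    have hk := toIcoMod_add_toIcoDiv_zsmul hs a z
    have h1 : Ψ (z + t) = Ψ (toIcoMod hs a z + t) := by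
      simp only [hΨ]
      conv_lhs => rw [← hk]
      rw [add_right_comm, toIcoMod_add_zsmul]
    rw [h1, hΨeq _ (by linarith [hmem.1]) (by linarith [hmem.2]),
      hpt _ hmem.1 (by linarith [hmem.2])]
  have hgrp : ∀ u ∈ AddSubgroup.closure {s, t}, ∀ z, Ψ (z + u) = Ψ z := by
    intro u hu
    induction hu using AddSubgroup.closure_induction with
    | mem u hu =>
      rcases hu with rfl | rfl
      · exact hΨs
      · exact hΨt
    | zero => simp
    | add u v _ _ h1 h2 => intro z; rw [← add_assoc, h2, h1]
    | neg u _ h1 => intro z; rw [← h1 (z + -u)]; simp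
  have hdense : Dense (AddSubgroup.closure {s, t} : Set ℝ) :=
    dense_addSubgroupClosure_pair_iff.mpr hirr
  by_contra hne
  have hopen : IsOpen {z | ψ z ≠ ψ x} := isOpen_ne_fun hψ continuous_const
  have hcl : y ∈ closure (Set.Ioo a b) := by
    rw [closure_Ioo (by linarith)]; exact ⟨hy, hyb⟩
  obtain ⟨w, hw1, hw2⟩ := mem_closure_iff.mp hcl _ hopen (fun h => hne h.symm)
  have hopen2 : IsOpen ((fun u => x + u) ⁻¹' ({z | ψ z ≠ ψ x} ∩ Set.Ioo a b)) :=
    (hopen.inter isOpen_Ioo).preimage (by fun_prop)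
  obtain ⟨u, hu1, hu2⟩ := hdense.exists_mem_open hopen2 ⟨w - x, by
    simp only [Set.mem_preimage, add_sub_cancel]; exact ⟨hw1, hw2⟩⟩
  obtain ⟨h1, h2⟩ := hu2
  apply h1
  rw [← hΨeq _ h2.1.le h2.2.le, ← hΨeq x hx hxb, hgrp u hu1]

/-! ## The shape of the functions -/

/-- `g` is the `bhk_irrational` function with `f = 4/5`, `d1 = 3/5`, `d2 = 1/10`, `a0 = 3/20`,
`δ1 = t`, `δ2 = 1/40 - t`, perturbed by `h` on the two intervals of slope zero. -/
structure Shape (t : ℝ) (h g : ℝ → ℝ) : Prop where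
  per : Function.Periodic g 1
  s1 : ∀ x, 0 ≤ x → x ≤ 2/15 → g x = 5/2 * x
  s2 : ∀ x, 2/15 ≤ x → x ≤ 3/20 → g x = 1/3 - 5 * (x - 2/15)
  s3 : ∀ x, 3/20 ≤ x → x ≤ 3/20 + 2*t/3 → g x = 1/4 + 5/2 * (x - 3/20)
  s4 : ∀ x, 3/20 + 2*t/3 ≤ x → x ≤ 3/20 + t → g x = 1/4 - 5 * (x - (3/20 + t))
  s5 : ∀ x, 3/20 + t ≤ x → x ≤ 1/6 + t/3 → g x = 1/4 + 5/2 * (x - (3/20 + t))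
  s6 : ∀ x, 1/6 + t/3 ≤ x → x ≤ 7/40 → g x = 1/4 - 5 * (x - 7/40)
  s7 : ∀ x, 7/40 ≤ x → x ≤ 11/40 → g x = 1/4 + 5/2 * (x - 7/40)
  s8 : ∀ x, 11/40 ≤ x → x ≤ 3/10 → g x = 3/8 - 5 * (x - 3/10)
  s9 : ∀ x, 3/10 ≤ x → x ≤ 7/20 → g x = 3/8 + h x
  s10 : ∀ x, 7/20 ≤ x → x ≤ 9/20 → g x = 3/8 + 5/2 * (x - 7/20)
  s11 : ∀ x, 9/20 ≤ x → x ≤ 1/2 → g x = 5/8 + h (x - 3/20)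
  s12 : ∀ x, 1/2 ≤ x → x ≤ 21/40 → g x = 5/8 - 5 * (x - 1/2)
  s13 : ∀ x, 21/40 ≤ x → x ≤ 5/8 → g x = 1/2 + 5/2 * (x - 21/40)
  s14 : ∀ x, 5/8 ≤ x → x ≤ 19/30 - t/3 → g x = 3/4 - 5 * (x - 5/8)
  s15 : ∀ x, 19/30 - t/3 ≤ x → x ≤ 13/20 - t → g x = 3/4 + 5/2 * (x - (13/20 - t))
  s16 : ∀ x, 13/20 - t ≤ x → x ≤ 13/20 - 2*t/3 → g x = 3/4 - 5 * (x - (13/20 - t))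
  s17 : ∀ x, 13/20 - 2*t/3 ≤ x → x ≤ 13/20 → g x = 3/4 + 5/2 * (x - 13/20)
  s18 : ∀ x, 13/20 ≤ x → x ≤ 2/3 → g x = 3/4 - 5 * (x - 13/20)
  s19 : ∀ x, 2/3 ≤ x → x ≤ 4/5 → g x = 1 + 5/2 * (x - 4/5)
  s20 : ∀ x, 4/5 ≤ x → x ≤ 1 → g x = 5 * (1 - x)

/-- Perturbations on the interval `[3/10, 7/20]` that preserve subadditivity. -/
structure IsPerturbation (t : ℝ) (h : ℝ → ℝ) : Prop where
  -- The periods are the distances of `3/20 + t` and `7/40` from `3/20`. Oddness about `13/40` keeps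
  -- pairs with sum `4/5` additive. The constant `5/2` is the rising slope, and `1/24` is chosen so
  -- that `3/8 - 1/24 + 2/3 = 1`, where `2/3` is the value at the local minimum `2/3`.
  per_t : ∀ x, h (x + t) = h x
  per_d : ∀ x, h (x + 1/40) = h x
  odd : ∀ x, h (13/20 - x) = -h x
  lip : ∀ x y, |h x - h y| ≤ 5/2 * |x - y|
  bound : ∀ x, |h x| ≤ 1/24
  zero : h (3/10) = 0

theorem isPerturbation_zero (t : ℝ) : IsPerturbation t fun _ => 0 where
  per_t _ := rfl
  per_d _ := rfl
  odd _ := by simp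
  lip _ _ := by simp
  bound _ := by norm_num
  zero := rfl

namespace IsPerturbation

variable {t : ℝ} {h : ℝ → ℝ}

theorem zero' (H : IsPerturbation t h) : h (7/20) = 0 := by
  have := H.odd (3/10)
  rw [H.zero] at this
  norm_num at this
  exact this

theorem le_add_of_le (H : IsPerturbation t h) {x y : ℝ} (hxy : x ≤ y) :
    h x ≤ h y + 5/2 * (y - x) ∧ h y ≤ h x + 5/2 * (y - x) := by
  have h1 := abs_le.mp (H.lip y x)
  rw [abs_of_nonneg (sub_nonneg.mpr hxy)] at h1
  constructor <;> linarith [h1.1, h1.2]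

theorem bounds (H : IsPerturbation t h) (x : ℝ) : -(1/24) ≤ h x ∧ h x ≤ 1/24 :=
  abs_le.mp (H.bound x)

/-- Values at two points whose sum is close to twice the centre almost cancel. -/
theorem add_ge (H : IsPerturbation t h) (x y : ℝ) :
    -(5/2 * |x + y - 13/20|) ≤ h x + h y := by
  have h1 := H.odd y
  have h2 := (abs_le.mp (H.lip x (13/20 - y))).1
  rw [show x - (13/20 - y) = x + y - 13/20 by ring] at h2
  linarith

theorem add_ge_t (H : IsPerturbation t h) (x y : ℝ) :
    -(5/2 * |x + y + t - 13/20|) ≤ h x + h y := by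
  have h1 := H.add_ge (x + t) y
  rwa [H.per_t, show x + t + y = x + y + t by ring] at h1

theorem add_ge_d (H : IsPerturbation t h) (x y : ℝ) :
    -(5/2 * |x + y - 5/8|) ≤ h x + h y := by
  have h1 := H.add_ge (x + 1/40) y
  rwa [H.per_d, show x + 1/40 + y - 13/20 = x + y - 5/8 by ring] at h1

end IsPerturbation

/-- The slopes of `g` between `a` and `b` are at least `-5` and at most `5/2`. -/
def SlopeOn (g : ℝ → ℝ) (a b : ℝ) : Prop :=
  ∀ x y, a ≤ x → x ≤ y → y ≤ b → g y ≤ g x + 5/2 * (y - x) ∧ g x ≤ g y + 5 * (y - x)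

theorem SlopeOn.trans {g : ℝ → ℝ} {a b c : ℝ} (h1 : SlopeOn g a b) (h2 : SlopeOn g b c) :
    SlopeOn g a c := by
  intro x y hx hxy hy
  rcases le_total y b with h | h
  · exact h1 x y hx hxy h
  rcases le_total b x with h' | h'
  · exact h2 x y h' hxy hy
  · have e1 := h1 x b hx h' le_rfl
    have e2 := h2 b y le_rfl h hy
    constructor <;> linarith [e1.1, e1.2, e2.1, e2.2]

theorem slopeOn_of_affine {g : ℝ → ℝ} {a b c v w : ℝ} (hc : c ≤ 5/2) (hc' : -5 ≤ c)
    (hg : ∀ x, a ≤ x → x ≤ b → g x = v + c * (x - w)) : SlopeOn g a b := by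
  intro x y hx hxy hy
  rw [hg x hx (hxy.trans hy), hg y (hx.trans hxy) hy]
  constructor <;> nlinarith

namespace Shape

variable {t : ℝ} {h g : ℝ → ℝ}

theorem cases (S : Shape t h g) {x : ℝ} (h0 : 0 ≤ x) (h1 : x ≤ 1) :
    (0 ≤ x ∧ x ≤ 2/15 ∧ g x = 5/2 * x) ∨
    (2/15 ≤ x ∧ x ≤ 3/20 ∧ g x = 1/3 - 5 * (x - 2/15)) ∨
    (3/20 ≤ x ∧ x ≤ 3/20 + 2*t/3 ∧ g x = 1/4 + 5/2 * (x - 3/20)) ∨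
    (3/20 + 2*t/3 ≤ x ∧ x ≤ 3/20 + t ∧ g x = 1/4 - 5 * (x - (3/20 + t))) ∨
    (3/20 + t ≤ x ∧ x ≤ 1/6 + t/3 ∧ g x = 1/4 + 5/2 * (x - (3/20 + t))) ∨
    (1/6 + t/3 ≤ x ∧ x ≤ 7/40 ∧ g x = 1/4 - 5 * (x - 7/40)) ∨
    (7/40 ≤ x ∧ x ≤ 11/40 ∧ g x = 1/4 + 5/2 * (x - 7/40)) ∨
    (11/40 ≤ x ∧ x ≤ 3/10 ∧ g x = 3/8 - 5 * (x - 3/10)) ∨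
    (3/10 ≤ x ∧ x ≤ 7/20 ∧ g x = 3/8 + h x) ∨
    (7/20 ≤ x ∧ x ≤ 9/20 ∧ g x = 3/8 + 5/2 * (x - 7/20)) ∨
    (9/20 ≤ x ∧ x ≤ 1/2 ∧ g x = 5/8 + h (x - 3/20)) ∨
    (1/2 ≤ x ∧ x ≤ 21/40 ∧ g x = 5/8 - 5 * (x - 1/2)) ∨
    (21/40 ≤ x ∧ x ≤ 5/8 ∧ g x = 1/2 + 5/2 * (x - 21/40)) ∨
    (5/8 ≤ x ∧ x ≤ 19/30 - t/3 ∧ g x = 3/4 - 5 * (x - 5/8)) ∨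
    (19/30 - t/3 ≤ x ∧ x ≤ 13/20 - t ∧ g x = 3/4 + 5/2 * (x - (13/20 - t))) ∨
    (13/20 - t ≤ x ∧ x ≤ 13/20 - 2*t/3 ∧ g x = 3/4 - 5 * (x - (13/20 - t))) ∨
    (13/20 - 2*t/3 ≤ x ∧ x ≤ 13/20 ∧ g x = 3/4 + 5/2 * (x - 13/20)) ∨
    (13/20 ≤ x ∧ x ≤ 2/3 ∧ g x = 3/4 - 5 * (x - 13/20)) ∨
    (2/3 ≤ x ∧ x ≤ 4/5 ∧ g x = 1 + 5/2 * (x - 4/5)) ∨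
    (4/5 ≤ x ∧ x ≤ 1 ∧ g x = 5 * (1 - x)) := by
  rcases le_total x (2/15) with h | l1
  · exact .inl ⟨h0, h, S.s1 x h0 h⟩
  rcases le_total x (3/20) with h | l2
  · exact .inr <| .inl ⟨l1, h, S.s2 x l1 h⟩
  rcases le_total x (3/20 + 2*t/3) with h | l3
  · exact .inr <| .inr <| .inl ⟨l2, h, S.s3 x l2 h⟩
  rcases le_total x (3/20 + t) with h | l4
  · exact .inr <| .inr <| .inr <| .inl ⟨l3, h, S.s4 x l3 h⟩
  rcases le_total x (1/6 + t/3) with h | l5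
  · exact .inr <| .inr <| .inr <| .inr <| .inl ⟨l4, h, S.s5 x l4 h⟩
  rcases le_total x (7/40) with h | l6
  · exact .inr <| .inr <| .inr <| .inr <| .inr <| .inl ⟨l5, h, S.s6 x l5 h⟩
  rcases le_total x (11/40) with h | l7
  · exact .inr <| .inr <| .inr <| .inr <| .inr <| .inr <| .inl ⟨l6, h, S.s7 x l6 h⟩
  iterate 7 refine .inr ?_
  rcases le_total x (3/10) with h | l8
  · exact .inl ⟨l7, h, S.s8 x l7 h⟩
  rcases le_total x (7/20) with h | l9
  · exact .inr <| .inl ⟨l8, h, S.s9 x l8 h⟩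
  rcases le_total x (9/20) with h | l10
  · exact .inr <| .inr <| .inl ⟨l9, h, S.s10 x l9 h⟩
  rcases le_total x (1/2) with h | l11
  · exact .inr <| .inr <| .inr <| .inl ⟨l10, h, S.s11 x l10 h⟩
  rcases le_total x (21/40) with h | l12
  · exact .inr <| .inr <| .inr <| .inr <| .inl ⟨l11, h, S.s12 x l11 h⟩
  rcases le_total x (5/8) with h | l13
  · exact .inr <| .inr <| .inr <| .inr <| .inr <| .inl ⟨l12, h, S.s13 x l12 h⟩
  iterate 6 refine .inr ?_
  rcases le_total x (19/30 - t/3) with h | l14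
  · exact .inl ⟨l13, h, S.s14 x l13 h⟩
  rcases le_total x (13/20 - t) with h | l15
  · exact .inr <| .inl ⟨l14, h, S.s15 x l14 h⟩
  rcases le_total x (13/20 - 2*t/3) with h | l16
  · exact .inr <| .inr <| .inl ⟨l15, h, S.s16 x l15 h⟩
  rcases le_total x (13/20) with h | l17
  · exact .inr <| .inr <| .inr <| .inl ⟨l16, h, S.s17 x l16 h⟩
  rcases le_total x (2/3) with h | l18
  · exact .inr <| .inr <| .inr <| .inr <| .inl ⟨l17, h, S.s18 x l17 h⟩
  rcases le_total x (4/5) with h | l19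
  · exact .inr <| .inr <| .inr <| .inr <| .inr <| .inl ⟨l18, h, S.s19 x l18 h⟩
  · exact .inr <| .inr <| .inr <| .inr <| .inr <| .inr ⟨l19, h1, S.s20 x l19 h1⟩

theorem bounds_unit (S : Shape t h g) (H : IsPerturbation t h) (ht : 0 < t) (ht' : t < 1/40)
    {x : ℝ} (h0 : 0 ≤ x) (h1 : x ≤ 1) : 0 ≤ g x ∧ g x ≤ 1 := by
  have b1 := H.bounds x
  have b2 := H.bounds (x - 3/20)
  rcases S.cases h0 h1 with e | e | e | e | e | e | e | e | e | e | e | e | e | e | e | e | e | e |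
    e | e <;> obtain ⟨e1, e2, e3⟩ := e <;> rw [e3] <;> constructor <;>
    linarith [b1.1, b1.2, b2.1, b2.2]

theorem fract_eq (S : Shape t h g) (x : ℝ) : g (Int.fract x) = g x := by
  have := S.per.sub_int_mul_eq ⌊x⌋ (x := x)
  rwa [mul_one] at this

theorem nonneg (S : Shape t h g) (H : IsPerturbation t h) (ht : 0 < t) (ht' : t < 1/40)
    (x : ℝ) : 0 ≤ g x := by
  rw [← S.fract_eq]
  exact (S.bounds_unit H ht ht' (Int.fract_nonneg x) (Int.fract_lt_one x).le).1

theorem le_one (S : Shape t h g) (H : IsPerturbation t h) (ht : 0 < t) (ht' : t < 1/40)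
    (x : ℝ) : g x ≤ 1 := by
  rw [← S.fract_eq]
  exact (S.bounds_unit H ht ht' (Int.fract_nonneg x) (Int.fract_lt_one x).le).2

theorem slopeOn_unit (S : Shape t h g) (H : IsPerturbation t h) : SlopeOn g 0 1 := by
  have up {a b v w : ℝ} (e : ∀ x, a ≤ x → x ≤ b → g x = v + 5/2 * (x - w)) : SlopeOn g a b :=
    slopeOn_of_affine le_rfl (by norm_num) e
  have down {a b v w : ℝ} (e : ∀ x, a ≤ x → x ≤ b → g x = v - 5 * (x - w)) : SlopeOn g a b :=
    slopeOn_of_affine (c := -5) (v := v) (w := w) (by norm_num) le_rfl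
      (fun x h1 h2 => by rw [e x h1 h2]; ring)
  have p1 : SlopeOn g 0 (2/15) := up (v := 0) (w := 0) (fun x h1 h2 => by rw [S.s1 x h1 h2]; ring)
  have p9 : SlopeOn g (3/10) (7/20) := by
    intro x y h1 h2 h3
    rw [S.s9 x h1 (h2.trans h3), S.s9 y (h1.trans h2) h3]
    have := H.le_add_of_le h2
    constructor <;> linarith [this.1, this.2]
  have p11 : SlopeOn g (9/20) (1/2) := by
    intro x y h1 h2 h3
    rw [S.s11 x h1 (h2.trans h3), S.s11 y (h1.trans h2) h3]
    have := H.le_add_of_le (x := x - 3/20) (y := y - 3/20) (by linarith)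
    constructor <;> linarith [this.1, this.2]
  have p20 : SlopeOn g (4/5) 1 := down (v := 0) (w := 1)
    (fun x h1 h2 => by rw [S.s20 x h1 h2]; ring)
  exact p1.trans <| (down S.s2).trans <| (up S.s3).trans <| (down S.s4).trans <|
    (up S.s5).trans <| (down S.s6).trans <| (up S.s7).trans <| (down S.s8).trans <| p9.trans <|
    (up S.s10).trans <| p11.trans <| (down S.s12).trans <| (up S.s13).trans <|
    (down S.s14).trans <| (up S.s15).trans <| (down S.s16).trans <| (up S.s17).trans <|
    (down S.s18).trans <| (up S.s19).trans p20

theorem map_zero (S : Shape t h g) : g 0 = 0 := by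
  rw [S.s1 0 le_rfl (by norm_num)]; norm_num

/-- If an integer lies between `x` and `y`, the bounds on one period are applied from that integer,
where `g` vanishes, and `g ≥ 0` absorbs the other value. -/
theorem slope (S : Shape t h g) (H : IsPerturbation t h) (ht : 0 < t) (ht' : t < 1/40)
    {x y : ℝ} (hxy : x ≤ y) : g y ≤ g x + 5/2 * (y - x) ∧ g x ≤ g y + 5 * (y - x) := by
  have hU := S.slopeOn_unit H
  have fx := Int.fract_add_floor x
  have fy := Int.fract_add_floor y
  have x0 := Int.fract_nonneg x
  have x1 := (Int.fract_lt_one x).le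
  have y0 := Int.fract_nonneg y
  have y1 := (Int.fract_lt_one y).le
  have nx := S.nonneg H ht ht' x
  have ny := S.nonneg H ht ht' y
  rw [← S.fract_eq x, ← S.fract_eq y] at *
  rcases (Int.floor_mono hxy).eq_or_lt with e | e
  · rw [e] at fx
    have := hU (Int.fract x) (Int.fract y) x0 (by linarith) y1
    constructor <;> linarith [this.1, this.2]
  · have e' : (⌊x⌋ : ℝ) + 1 ≤ ⌊y⌋ := by exact_mod_cast e
    have h1 := (hU 0 (Int.fract y) le_rfl y0 y1).1
    have h2 := (hU (Int.fract x) 1 x0 x1 le_rfl).2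
    rw [S.map_zero] at h1
    rw [S.s20 1 (by norm_num) le_rfl] at h2
    constructor <;> linarith

end Shape

/-! ## Subadditivity -/

/-- The right ends of the zigzags after the first rise and fall. -/
def IsZigzagEnd (t s : ℝ) : Prop := s = 3/20 ∨ s = 3/20 + t ∨ s = 7/40

/-- The local minima between `1/2` and `4/5`. -/
def IsHighMin (t s : ℝ) : Prop :=
  s = 21/40 ∨ s = 19/30 - t/3 ∨ s = 13/20 - 2*t/3 ∨ s = 2/3

/-- The points at which subadditivity has to be checked. -/
def IsLow (t s : ℝ) : Prop :=
  s = 0 ∨ s = 1 ∨ IsZigzagEnd t s ∨ (3/10 ≤ s ∧ s ≤ 7/20) ∨ (9/20 ≤ s ∧ s ≤ 1/2) ∨ IsHighMin t s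

namespace Shape

variable {t : ℝ} {h g : ℝ → ℝ}

theorem zigzagEnd (S : Shape t h g) (ht : 0 < t) (ht' : t < 1/40) {s : ℝ}
    (hs : IsZigzagEnd t s) : 3/20 ≤ s ∧ s ≤ 7/40 ∧ g s = 1/4 := by
  rcases hs with rfl | rfl | rfl
  · refine ⟨by linarith, by linarith, ?_⟩
    rw [S.s3 _ (by linarith) (by linarith)]; ring
  · refine ⟨by linarith, by linarith, ?_⟩
    rw [S.s5 _ (by linarith) (by linarith)]; ring
  · refine ⟨by linarith, by linarith, ?_⟩
    rw [S.s7 _ (by linarith) (by linarith)]; ring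

/-- From `x` one descends along its affine piece to the lower end, and on a flat piece one stays.
One of the two inequalities is then an equality and the other follows from the sign of `x - s`. Both
are needed since, for two points, the sign of the total displacement is not known beforehand. -/
theorem exists_low_unit (S : Shape t h g) (ht : 0 < t) (ht' : t < 1/40) {x : ℝ} (h0 : 0 ≤ x)
    (h1 : x ≤ 1) : ∃ s, IsLow t s ∧ g s + 5/2 * (x - s) ≤ g x ∧ g s - 5 * (x - s) ≤ g x := by
  have z := S.map_zero
  have z1 : g 1 = 0 := by rw [S.s20 1 (by norm_num) le_rfl]; norm_num
  have a0 := S.zigzagEnd ht ht' (s := 3/20) (.inl rfl)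
  have a1 := S.zigzagEnd ht ht' (s := 3/20 + t) (.inr (.inl rfl))
  have a2 := S.zigzagEnd ht ht' (s := 7/40) (.inr (.inr rfl))
  have e3 := S.s8 (3/10) (by norm_num) le_rfl
  have e4 := S.s10 (7/20) le_rfl (by norm_num)
  have m3 := S.s13 (21/40) le_rfl (by norm_num)
  have m2 := S.s14 (19/30 - t/3) (by linarith) le_rfl
  have m1 := S.s16 (13/20 - 2*t/3) (by linarith) le_rfl
  have m0 := S.s18 (2/3) (by norm_num) le_rfl
  have lz : ∀ {s}, IsZigzagEnd t s → IsLow t s := fun hs => .inr (.inr (.inl hs))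
  have lh : ∀ {s}, IsHighMin t s → IsLow t s := fun hs => .inr (.inr (.inr (.inr (.inr hs))))
  have lA : ∀ {s}, 3/10 ≤ s → s ≤ 7/20 → IsLow t s :=
    fun h1 h2 => .inr (.inr (.inr (.inl ⟨h1, h2⟩)))
  have lB : ∀ {s}, 9/20 ≤ s → s ≤ 1/2 → IsLow t s :=
    fun h1 h2 => .inr (.inr (.inr (.inr (.inl ⟨h1, h2⟩))))
  rcases S.cases h0 h1 with e | e | e | e | e | e | e | e | e | e | e | e | e | e | e | e | e | e |
    e | e <;> obtain ⟨e1, e2, e⟩ := e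
  · exact ⟨0, .inl rfl, by constructor <;> linarith only [e, e1, e2, z]⟩
  · exact ⟨_, lz (.inl rfl), by constructor <;> linarith only [e, e1, e2, a0.2.2]⟩
  · exact ⟨_, lz (.inl rfl), by constructor <;> linarith only [e, e1, e2, a0.2.2]⟩
  · exact ⟨_, lz (.inr (.inl rfl)), by constructor <;> linarith only [e, e1, e2, a1.2.2]⟩
  · exact ⟨_, lz (.inr (.inl rfl)), by constructor <;> linarith only [e, e1, e2, a1.2.2]⟩
  · exact ⟨_, lz (.inr (.inr rfl)), by constructor <;> linarith only [e, e1, e2, a2.2.2]⟩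
  · exact ⟨_, lz (.inr (.inr rfl)), by constructor <;> linarith only [e, e1, e2, a2.2.2]⟩
  · exact ⟨3/10, lA le_rfl (by norm_num), by constructor <;> linarith only [e, e1, e2, e3]⟩
  · exact ⟨x, lA e1 e2, by constructor <;> linarith only⟩
  · exact ⟨7/20, lA (by norm_num) le_rfl, by constructor <;> linarith only [e, e1, e2, e4]⟩
  · exact ⟨x, lB e1 e2, by constructor <;> linarith only⟩
  · exact ⟨21/40, lh (.inl rfl), by constructor <;> linarith only [e, e1, e2, m3]⟩
  · exact ⟨21/40, lh (.inl rfl), by constructor <;> linarith only [e, e1, e2, m3]⟩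
  · exact ⟨_, lh (.inr (.inl rfl)), by constructor <;> linarith only [e, e1, e2, m2]⟩
  · exact ⟨_, lh (.inr (.inl rfl)), by constructor <;> linarith only [e, e1, e2, m2]⟩
  · exact ⟨_, lh (.inr (.inr (.inl rfl))), by constructor <;> linarith only [e, e1, e2, m1]⟩
  · exact ⟨_, lh (.inr (.inr (.inl rfl))), by constructor <;> linarith only [e, e1, e2, m1]⟩
  · exact ⟨_, lh (.inr (.inr (.inr rfl))), by constructor <;> linarith only [e, e1, e2, m0]⟩
  · exact ⟨_, lh (.inr (.inr (.inr rfl))), by constructor <;> linarith only [e, e1, e2, m0]⟩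
  · exact ⟨1, .inr (.inl rfl), by constructor <;> linarith only [e, e1, e2, z1]⟩

theorem highMin (S : Shape t h g) (ht : 0 < t) (ht' : t < 1/40) {s : ℝ}
    (hs : IsHighMin t s) : 1/2 ≤ g s := by
  rcases hs with rfl | rfl | rfl | rfl
  · rw [S.s13 _ (by linarith) (by linarith)]; norm_num
  · rw [S.s14 _ (by linarith) (by linarith)]; linarith
  · rw [S.s17 _ (by linarith) (by linarith)]; linarith
  · rw [S.s18 _ (by linarith) (by linarith)]; norm_num

/-- Near the peak, `g` is at most the tent through the peak. -/
theorem le_tent (S : Shape t h g) {z : ℝ} (h0 : 2/3 ≤ z) (h1 : z ≤ 1) :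
    g z ≤ 1 + 5/2 * (z - 4/5) ∧ z ≤ 4/5 ∨ g z ≤ 1 - 5 * (z - 4/5) ∧ 4/5 ≤ z := by
  rcases le_total z (4/5) with e | e
  · exact .inl ⟨by rw [S.s19 z h0 e], e⟩
  · exact .inr ⟨by rw [S.s20 z e h1]; linarith, e⟩

theorem sub_zigzagEnd_zigzagEnd (S : Shape t h g) (H : IsPerturbation t h) (ht : 0 < t)
    (ht' : t < 1/40) {a b : ℝ} (ha : IsZigzagEnd t a) (hb : IsZigzagEnd t b) :
    g (a + b) ≤ g a + g b := by
  obtain ⟨a1, a2, a3⟩ := S.zigzagEnd ht ht' ha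
  obtain ⟨b1, b2, b3⟩ := S.zigzagEnd ht ht' hb
  rw [a3, b3, S.s9 _ (by linarith) (by linarith)]
  linarith [(H.bounds (a + b)).2]

/-- Up to `1/2` this is an equality, by the two periods of `h`. Beyond `1/2` the fall of slope `-5`
outweighs any fall of `h`. -/
theorem sub_zigzagEnd_flat (S : Shape t h g) (H : IsPerturbation t h) (ht : 0 < t)
    (ht' : t < 1/40) {a b : ℝ} (ha : IsZigzagEnd t a) (hb : 3/10 ≤ b) (hb' : b ≤ 7/20) :
    g (a + b) ≤ g a + g b := by
  obtain ⟨a1, a2, a3⟩ := S.zigzagEnd ht ht' ha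
  have hsh : h (a + b - 3/20) = h b := by
    rcases ha with rfl | rfl | rfl
    · congr 1; ring
    · rw [show 3/20 + t + b - 3/20 = b + t by ring, H.per_t]
    · rw [show 7/40 + b - 3/20 = b + 1/40 by ring, H.per_d]
  rw [a3, S.s9 b hb hb']
  rcases le_total (a + b) (1/2) with e | e
  · rw [S.s11 _ (by linarith) e, hsh]; linarith
  · rw [S.s12 _ e (by linarith), ← hsh]
    have := (H.le_add_of_le (x := 7/20) (y := a + b - 3/20) (by linarith)).1
    rw [H.zero'] at this
    linarith

theorem sub_zigzagEnd_upperFlat (S : Shape t h g) (H : IsPerturbation t h) (ht : 0 < t)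
    (ht' : t < 1/40) {a b : ℝ} (ha : IsZigzagEnd t a) (hb : 9/20 ≤ b) (hb' : b ≤ 1/2) :
    g (a + b) ≤ g a + g b := by
  obtain ⟨a1, a2, a3⟩ := S.zigzagEnd ht ht' ha
  rw [a3, S.s11 b hb hb']
  have hB := (H.bounds (b - 3/20)).1
  have p := S.s14 (5/8) le_rfl (by linarith)
  rcases le_total (a + b) (5/8) with e | e
  · rw [S.s13 _ (by linarith) e]; linarith
  · have := (S.slope H ht ht' e).1
    have q := S.s18 (13/20) le_rfl (by norm_num)
    rcases le_total (a + b) (13/20) with e' | e'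
    · linarith
    · have := (S.slope H ht ht' e').1
      linarith

theorem sub_zigzagEnd_highMin (S : Shape t h g) (H : IsPerturbation t h) (ht : 0 < t)
    (ht' : t < 1/40) {a b : ℝ} (ha : IsZigzagEnd t a) (hb : IsHighMin t b) :
    g (a + b) ≤ g a + g b := by
  obtain ⟨a1, a2, a3⟩ := S.zigzagEnd ht ht' ha
  rw [a3]
  rcases hb with rfl | rfl | rfl | rfl
  · rw [S.s13 (21/40) le_rfl (by norm_num)]
    have m0 := S.s19 (2/3) le_rfl (by norm_num)
    have := (S.slope H ht ht' (x := 2/3) (y := a + 21/40) (by linarith)).1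
    linarith
  · rw [S.s14 _ (by linarith) le_rfl]
    rcases S.le_tent (z := a + (19/30 - t/3)) (by linarith) (by linarith) with e | e <;>
    rcases ha with h | h | h <;> linarith [e.1, e.2]
  · rw [S.s17 _ le_rfl (by linarith)]
    rcases S.le_tent (z := a + (13/20 - 2*t/3)) (by linarith) (by linarith) with e | e <;>
    rcases ha with h | h | h <;> linarith [e.1, e.2]
  · rw [S.s18 (2/3) (by norm_num) le_rfl]
    rcases S.le_tent (z := a + 2/3) (by linarith) (by linarith) with e | e <;>
    linarith [e.1, e.2]

/-- The sum runs through the upper zigzags, whose peaks `5/8`, `13/20 - t` and `13/20` all have the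
value `3/4`, twice that of the flat piece. Oddness, combined with each period, makes `h a + h b`
vanish when the sum is a peak and bounds it below by `-5/2` times the distance to the peak, which no
adjacent slope violates. After `2/3` the zero of `h` at `7/20` takes over. -/
theorem sub_flat_flat (S : Shape t h g) (H : IsPerturbation t h) (ht : 0 < t)
    (ht' : t < 1/40) {a b : ℝ} (ha : 3/10 ≤ a) (ha' : a ≤ 7/20) (hb : 3/10 ≤ b)
    (hb' : b ≤ 7/20) : g (a + b) ≤ g a + g b := by
  rw [S.s9 a ha ha', S.s9 b hb hb']
  have k0 := H.add_ge a b
  have k1 := H.add_ge_t a b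
  have k2 := H.add_ge_d a b
  rcases le_total (a + b) (5/8) with c1 | c1
  · rw [S.s13 _ (by linarith) c1]
    rw [abs_of_nonpos (by linarith)] at k2
    linarith
  rw [abs_of_nonneg (by linarith)] at k2
  rcases le_total (a + b) (19/30 - t/3) with c2 | c2
  · rw [S.s14 _ c1 c2]
    linarith
  rcases le_total (a + b) (13/20 - t) with c3 | c3
  · rw [S.s15 _ c2 c3]
    rw [abs_of_nonpos (by linarith)] at k1
    linarith
  rw [abs_of_nonneg (by linarith)] at k1
  rcases le_total (a + b) (13/20 - 2*t/3) with c4 | c4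
  · rw [S.s16 _ c3 c4]
    linarith
  rcases le_total (a + b) (13/20) with c5 | c5
  · rw [S.s17 _ c4 c5]
    rw [abs_of_nonpos (by linarith)] at k0
    linarith
  rw [abs_of_nonneg (by linarith)] at k0
  rcases le_total (a + b) (2/3) with c6 | c6
  · rw [S.s18 _ c5 c6]
    linarith
  · rw [S.s19 _ c6 (by linarith)]
    have l1 := (H.le_add_of_le ha').2
    have l2 := (H.le_add_of_le hb').2
    rw [H.zero'] at l1 l2
    linarith

/-- Here the peak is `4/5`: `h a + h (b - 3/20)` vanishes when `a + b = 4/5`, and the tent falls at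
least as fast as the Lipschitz bound allows. -/
theorem sub_flat_upperFlat (S : Shape t h g) (H : IsPerturbation t h) {a b : ℝ} (ha : 3/10 ≤ a)
    (ha' : a ≤ 7/20) (hb : 9/20 ≤ b) (hb' : b ≤ 1/2) : g (a + b) ≤ g a + g b := by
  rw [S.s9 a ha ha', S.s11 b hb hb']
  have k0 := H.add_ge a (b - 3/20)
  rcases S.le_tent (z := a + b) (by linarith) (by linarith) with ⟨e, e'⟩ | ⟨e, e'⟩
  · rw [abs_of_nonpos (by linarith)] at k0
    linarith
  · rw [abs_of_nonneg (by linarith)] at k0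
    linarith

theorem sub_flat_highMin (S : Shape t h g) (H : IsPerturbation t h) (ht : 0 < t)
    (ht' : t < 1/40) {a b : ℝ} (ha : 3/10 ≤ a) (ha' : a ≤ 7/20) (hb : IsHighMin t b) :
    g (a + b) ≤ g a + g b := by
  have hB := (H.bounds a).1
  have one := S.le_one H ht ht' (a + b)
  rw [S.s9 a ha ha']
  rcases hb with rfl | rfl | rfl | rfl
  · rw [S.s13 (21/40) le_rfl (by norm_num), S.s20 _ (by linarith) (by linarith)]
    have l1 := (H.le_add_of_le ha).1
    rw [H.zero] at l1
    linarith
  · rw [S.s14 (19/30 - t/3) (by linarith) le_rfl]; linarith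
  · rw [S.s17 (13/20 - 2*t/3) le_rfl (by linarith)]; linarith
  · rw [S.s18 (2/3) (by norm_num) le_rfl]; linarith

theorem sub_of_isLow (S : Shape t h g) (H : IsPerturbation t h) (ht : 0 < t) (ht' : t < 1/40)
    {a b : ℝ} (ha : IsLow t a) (hb : IsLow t b) : g (a + b) ≤ g a + g b := by
  have triv : ∀ x y, 1/2 ≤ g x → 1/2 ≤ g y → g (x + y) ≤ g x + g y := fun x y h1 h2 => by
    linarith [S.le_one H ht ht' (x + y)]
  have hB : ∀ x, 9/20 ≤ x ∧ x ≤ 1/2 → 1/2 ≤ g x := fun x hx => by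
    rw [S.s11 x hx.1 hx.2]; linarith [(H.bounds (x - 3/20)).1]
  have hM : ∀ x, IsHighMin t x → 1/2 ≤ g x := fun x hx => S.highMin ht ht' hx
  have z : ∀ y, g (0 + y) ≤ g 0 + g y := fun y => by rw [S.map_zero]; simp
  have z1 : ∀ y, g (1 + y) ≤ g 1 + g y := fun y => by
    rw [S.s20 1 (by norm_num) le_rfl, add_comm 1 y, S.per]; linarith
  have comm : ∀ {x y}, g (y + x) ≤ g y + g x → g (x + y) ≤ g x + g y := fun h => by
    rw [add_comm, add_comm (g _)]; exact h
  rcases ha with rfl | rfl | ha | ha | ha | ha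
  · exact z b
  · exact z1 b
  · rcases hb with rfl | rfl | hb | hb | hb | hb
    · exact comm (z a)
    · exact comm (z1 a)
    · exact S.sub_zigzagEnd_zigzagEnd H ht ht' ha hb
    · exact S.sub_zigzagEnd_flat H ht ht' ha hb.1 hb.2
    · exact S.sub_zigzagEnd_upperFlat H ht ht' ha hb.1 hb.2
    · exact S.sub_zigzagEnd_highMin H ht ht' ha hb
  · rcases hb with rfl | rfl | hb | hb | hb | hb
    · exact comm (z a)
    · exact comm (z1 a)
    · exact comm (S.sub_zigzagEnd_flat H ht ht' hb ha.1 ha.2)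
    · exact S.sub_flat_flat H ht ht' ha.1 ha.2 hb.1 hb.2
    · exact S.sub_flat_upperFlat H ha.1 ha.2 hb.1 hb.2
    · exact S.sub_flat_highMin H ht ht' ha.1 ha.2 hb
  · rcases hb with rfl | rfl | hb | hb | hb | hb
    · exact comm (z a)
    · exact comm (z1 a)
    · exact comm (S.sub_zigzagEnd_upperFlat H ht ht' hb ha.1 ha.2)
    · exact comm (S.sub_flat_upperFlat H hb.1 hb.2 ha.1 ha.2)
    · exact triv a b (hB a ha) (hB b hb)
    · exact triv a b (hB a ha) (hM b hb)
  · rcases hb with rfl | rfl | hb | hb | hb | hb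
    · exact comm (z a)
    · exact comm (z1 a)
    · exact comm (S.sub_zigzagEnd_highMin H ht ht' hb ha)
    · exact comm (S.sub_flat_highMin H ht ht' hb.1 hb.2 ha)
    · exact triv a b (hM a ha) (hB b hb)
    · exact triv a b (hM a ha) (hM b hb)

/-- Both points are moved to points of `IsLow`. By `slope`, `g (x + y)` exceeds `g (a + b)` by no
more than the lower bounds from `exists_low_unit` add to `g a + g b`. -/
theorem subadditive (S : Shape t h g) (H : IsPerturbation t h) (ht : 0 < t) (ht' : t < 1/40)
    (x y : ℝ) : g (x + y) ≤ g x + g y := by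
  obtain ⟨a, ha, ha1, ha2⟩ :=
    S.exists_low_unit ht ht' (Int.fract_nonneg x) (Int.fract_lt_one x).le
  obtain ⟨b, hb, hb1, hb2⟩ :=
    S.exists_low_unit ht ht' (Int.fract_nonneg y) (Int.fract_lt_one y).le
  have hab := S.sub_of_isLow H ht ht' ha hb
  have e : g (x + y) = g (Int.fract x + Int.fract y) := by
    have := S.per.sub_int_mul_eq (⌊x⌋ + ⌊y⌋) (x := x + y)
    rw [← this]
    congr 1
    simp only [Int.fract]
    push_cast
    ring
  rw [e, ← S.fract_eq x, ← S.fract_eq y]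
  rcases le_total (a + b) (Int.fract x + Int.fract y) with l | l
  · have := (S.slope H ht ht' l).1
    linarith
  · have := (S.slope H ht ht' l).2
    linarith

theorem isValid (S : Shape t h g) (H : IsPerturbation t h) (ht : 0 < t) (ht' : t < 1/40) :
    IsValid (4/5) g :=
  isValid_of_subadditive S.map_zero (S.nonneg H ht ht') (S.subadditive H ht ht') S.per (by
    rw [S.s20 _ le_rfl (by norm_num)]; norm_num)

end Shape

/-! ## Extremality for incommensurable zigzags -/

namespace Shape

variable {t : ℝ} {g : ℝ → ℝ}

theorem symmetric_unit (S : Shape t (fun _ => 0) g) {x : ℝ} (h0 : 0 ≤ x) (h1 : x ≤ 1) :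
    g x + g (4/5 - x) = 1 := by
  rcases S.cases h0 h1 with e | e | e | e | e | e | e | e | e | e | e | e | e | e | e | e | e | e |
    e | e <;> obtain ⟨e1, e2, e3⟩ := e
  · rw [e3, S.s19 _ (by linarith) (by linarith)]; ring
  · rw [e3, S.s18 _ (by linarith) (by linarith)]; ring
  · rw [e3, S.s17 _ (by linarith) (by linarith)]; ring
  · rw [e3, S.s16 _ (by linarith) (by linarith)]; ring
  · rw [e3, S.s15 _ (by linarith) (by linarith)]; ring
  · rw [e3, S.s14 _ (by linarith) (by linarith)]; ring
  · rw [e3, S.s13 _ (by linarith) (by linarith)]; ring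
  · rw [e3, S.s12 _ (by linarith) (by linarith)]; ring
  · rw [e3, S.s11 _ (by linarith) (by linarith)]; ring
  · rw [e3, S.s10 _ (by linarith) (by linarith)]; ring
  · rw [e3, S.s9 _ (by linarith) (by linarith)]; ring
  · rw [e3, S.s8 _ (by linarith) (by linarith)]; ring
  · rw [e3, S.s7 _ (by linarith) (by linarith)]; ring
  · rw [e3, S.s6 _ (by linarith) (by linarith)]; ring
  · rw [e3, S.s5 _ (by linarith) (by linarith)]; ring
  · rw [e3, S.s4 _ (by linarith) (by linarith)]; ring
  · rw [e3, S.s3 _ (by linarith) (by linarith)]; ring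
  · rw [e3, S.s2 _ (by linarith) (by linarith)]; ring
  · rw [e3, S.s1 _ (by linarith) (by linarith)]; ring
  · rw [e3, ← S.per (4/5 - x), S.s20 _ (by linarith) (by linarith)]; ring

theorem symmetric (S : Shape t (fun _ => 0) g) (x : ℝ) : g x + g (4/5 - x) = 1 := by
  have h1 := S.symmetric_unit (Int.fract_nonneg x) (Int.fract_lt_one x).le
  have h2 := S.per.int_mul ⌊x⌋ (4/5 - x)
  rw [S.fract_eq, Int.fract, sub_sub_eq_add_sub, add_sub_right_comm] at h1
  rw [mul_one] at h2
  rwa [h2] at h1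

theorem neg_eq (S : Shape t (fun _ => 0) g) {u : ℝ} (h0 : 0 ≤ u) (h1 : u ≤ 1/5) :
    g (-u) = 5 * u := by
  rw [← S.per, S.s20 _ (by linarith) (by linarith)]; ring

/-- Equal slopes carry equality from breakpoint to breakpoint on `[0, 2/5]`; symmetry and the last
fall cover the rest of a period. The lengths `2/15` and `1/5` in the hypotheses are those of the
first rise and the last fall, the steps for which the slopes of `θ` are known. -/
theorem eq_of_slopes (S : Shape t (fun _ => 0) g) (ht : 0 < t) (ht' : t < 1/40) {θ : ℝ → ℝ}
    (hsym : ∀ x, θ x + θ (4/5 - x) = 1) (hper : Function.Periodic θ 1)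
    (hup0 : ∀ x, 0 ≤ x → x ≤ 2/15 → θ x = 5/2 * x)
    (hdown0 : ∀ u, 0 ≤ u → u ≤ 1/5 → θ (-u) = 5 * u)
    (hup : ∀ x y, x ≤ y → y ≤ x + 2/15 → g y = g x + 5/2 * (y - x) →
      θ y = θ x + 5/2 * (y - x))
    (hdown : ∀ x y, x ≤ y → y ≤ x + 1/5 → g y = g x - 5 * (y - x) →
      θ y = θ x - 5 * (y - x))
    (haff : ∀ x, 3/10 ≤ x → x ≤ 7/20 → θ x = θ (3/10) + 0 * (x - 3/10)) : θ = g := by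
  have a0 := (S.zigzagEnd ht ht' (s := 3/20) (.inl rfl)).2.2
  have a1 := (S.zigzagEnd ht ht' (s := 3/20 + t) (.inr (.inl rfl))).2.2
  have a2 := (S.zigzagEnd ht ht' (s := 7/40) (.inr (.inr rfl))).2.2
  have g1 : g (2/15) = 1/3 := by rw [S.s1 _ (by norm_num) le_rfl]; norm_num
  have g4 : g (3/10) = 3/8 := by rw [S.s9 _ le_rfl (by norm_num)]; norm_num
  have g5 : g (7/20) = 3/8 := by rw [S.s9 _ (by norm_num) le_rfl]; norm_num
  have b1 : θ (2/15) = 1/3 := by rw [hup0 _ (by norm_num) le_rfl]; norm_num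
  have b2 := hdown (2/15) (3/20) (by norm_num) (by norm_num) (by rw [a0, g1]; norm_num)
  have b3 := hup (3/20) (3/20 + 2*t/3) (by linarith) (by linarith) (by
    rw [a0, S.s3 _ (by linarith) le_rfl])
  have b4 := hdown (3/20 + 2*t/3) (3/20 + t) (by linarith) (by linarith) (by
    rw [a1, S.s3 _ (by linarith) le_rfl]; ring)
  have b5 := hup (3/20 + t) (1/6 + t/3) (by linarith) (by linarith) (by
    rw [a1, S.s5 _ (by linarith) le_rfl])
  have b6 := hdown (1/6 + t/3) (7/40) (by linarith) (by linarith) (by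
    rw [a2, S.s5 _ (by linarith) le_rfl]; ring)
  have b7 := hup (7/40) (11/40) (by norm_num) (by norm_num) (by
    rw [a2, S.s7 _ (by norm_num) le_rfl])
  have b8 := hdown (11/40) (3/10) (by norm_num) (by norm_num) (by
    rw [g4, S.s8 _ le_rfl (by norm_num)]; norm_num)
  have b9 := haff (7/20) (by norm_num) le_rfl
  have c0 : θ (3/20) = 1/4 := by linarith only [b1, b2]
  have c1 : θ (3/20 + t) = 1/4 := by linarith only [c0, b3, b4]
  have c2 : θ (7/40) = 1/4 := by linarith only [c1, b5, b6]
  have c3 : θ (3/10) = 3/8 := by linarith only [c2, b7, b8]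
  have c4 : θ (7/20) = 3/8 := by linarith only [c3, b9]
  have hhalf : ∀ x, 0 ≤ x → x ≤ 2/5 → θ x = g x := by
    intro x h0 h1
    rcases S.cases h0 (by linarith) with e | e | e | e | e | e | e | e | e | e | e | e | e | e | e |
      e | e | e | e | e <;> obtain ⟨e1, e2, e⟩ := e
    · rw [e, hup0 x e1 e2]
    · have := hdown (2/15) x e1 (by linarith) (by rw [e, g1])
      linarith only [this, e, b1]
    · have := hup (3/20) x e1 (by linarith) (by rw [e, a0])
      linarith only [this, e, c0]
    · have := hdown x (3/20 + t) e2 (by linarith) (by rw [e, a1]; ring)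
      linarith only [this, e, c1]
    · have := hup (3/20 + t) x e1 (by linarith) (by rw [e, a1])
      linarith only [this, e, c1]
    · have := hdown x (7/40) e2 (by linarith) (by rw [e, a2]; ring)
      linarith only [this, e, c2]
    · have := hup (7/40) x e1 (by linarith) (by rw [e, a2])
      linarith only [this, e, c2]
    · have := hdown x (3/10) e2 (by linarith) (by rw [e, g4]; ring)
      linarith only [this, e, c3]
    · have := haff x e1 e2
      linarith only [this, e, c3]
    · have := hup (7/20) x e1 (by linarith) (by rw [e, g5])
      linarith only [this, e, c4]
    all_goals exfalso; linarith only [e1, h1, ht, ht']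
  have hunit : ∀ x, 0 ≤ x → x ≤ 1 → θ x = g x := by
    intro x h0 h1
    rcases le_total x (2/5) with h | h
    · exact hhalf x h0 h
    rcases le_total x (4/5) with h' | h'
    · have e1 := hhalf (4/5 - x) (by linarith) (by linarith)
      have e2 := hsym x
      have e3 := S.symmetric x
      linarith
    · have e1 := hdown0 (1 - x) (by linarith) (by linarith)
      have e2 := S.neg_eq (u := 1 - x) (by linarith) (by linarith)
      rw [neg_sub] at e1 e2
      rw [← hper.sub_eq, ← S.per.sub_eq, e1, e2]
  funext x
  have h1 := hper.sub_int_mul_eq ⌊x⌋ (x := x)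
  rw [mul_one] at h1
  rw [← h1, ← S.fract_eq]
  exact hunit _ (Int.fract_nonneg x) (Int.fract_lt_one x).le

/-- A symmetric valid function that is additive wherever `g` is additive equals `g`. -/
theorem eq_of_additive (S : Shape t (fun _ => 0) g) (ht : 0 < t) (ht' : t < 1/40)
    (hirr : Irrational t) {θ : ℝ → ℝ} (hnn : ∀ x, 0 ≤ θ x) (hle : ∀ x, θ x ≤ 2 * g x)
    (hsym : ∀ x, θ x + θ (4/5 - x) = 1) (hsub : ∀ x y, θ (x + y) ≤ θ x + θ y)
    (hper : Function.Periodic θ 1)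
    (hadd : ∀ x y, g x + g y = g (x + y) → θ (x + y) = θ x + θ y) : θ = g := by
  have H := isPerturbation_zero t
  have hθ0 : θ 0 = 0 := by
    have h1 := hnn 0
    have h2 := hle 0
    rw [S.map_zero] at h2
    linarith
  have hθ1 : ∀ x, θ x ≤ 1 := fun x => by linarith [hsym x, hnn (4/5 - x)]
  have hθabs : ∀ x, |θ x| ≤ 1 := fun x => abs_le.mpr ⟨by linarith [hnn x], hθ1 x⟩
  -- The domination `θ ≤ 2 * g` and the slope bound `5` of `g` control `θ` near `0`; subadditivity
  -- spreads this to a global Lipschitz bound.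
  have hsmall : ∀ u, θ u ≤ 10 * |u| := by
    intro u
    have h2 := hle u
    have h0 := S.map_zero
    rcases le_total 0 u with h | h
    · have := (S.slope H ht ht' h).1
      rw [abs_of_nonneg h]; linarith
    · have := (S.slope H ht ht' h).2
      rw [abs_of_nonpos h]; linarith
  have hlip : LipschitzWith 10 θ := by
    refine LipschitzWith.of_dist_le_mul fun x y => ?_
    rw [Real.dist_eq, Real.dist_eq, abs_le]
    push_cast
    have h1 := hsub x (y - x)
    have h2 := hsub y (x - y)
    have h3 := hsmall (y - x)
    have h4 := hsmall (x - y)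
    rw [add_sub_cancel] at h1 h2
    rw [abs_sub_comm y x] at h3
    constructor <;> linarith
  -- slopes of `θ` on the rising and on the falling intervals
  set κ := θ (2/15) / (2/15) with hκ
  have hup0 : ∀ x, 0 ≤ x → x ≤ 2/15 → θ x = κ * x := fun x h0 h1 =>
    linear_of_additive_of_bounded (by norm_num) (fun x _ _ => hθabs x) (fun x y h0 h1 h2 =>
      hadd x y (by
        rw [S.s1 x h0 (by linarith), S.s1 y h1 (by linarith), S.s1 _ (by linarith) h2]
        ring)) h0 h1
  have hdown0 : ∀ u, 0 ≤ u → u ≤ 1/5 → θ (-u) = 5 * u := by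
    intro u h0 h1
    have := linear_of_additive_of_bounded (φ := fun u => θ (-u)) (a := 1/5) (M := 1) (by norm_num)
      (fun x _ _ => hθabs _) (fun x y h0 h1 h2 => by
        rw [neg_add]
        refine hadd _ _ ?_
        rw [← neg_add, S.neg_eq h0 (by linarith), S.neg_eq h1 (by linarith),
          S.neg_eq (by linarith) h2]
        ring) h0 h1
    -- The slope is fixed by `θ (-1/5) = θ (4/5) = 1`.
    have h2 := hsym 0
    rw [hθ0, sub_zero, zero_add] at h2
    have h3 := hper (-(1/5))
    rw [show (-(1/5) + 1 : ℝ) = 4/5 by norm_num, h2] at h3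
    rw [this, ← h3]
    ring
  have hup : ∀ x y, x ≤ y → y ≤ x + 2/15 → g y = g x + 5/2 * (y - x) →
      θ y = θ x + κ * (y - x) := by
    intro x y h0 h1 h2
    have h3 := hadd x (y - x) (by
      rw [add_sub_cancel, h2, S.s1 (y - x) (by linarith) (by linarith)])
    rwa [add_sub_cancel, hup0 (y - x) (by linarith) (by linarith)] at h3
  have hdown : ∀ x y, x ≤ y → y ≤ x + 1/5 → g y = g x - 5 * (y - x) →
      θ y = θ x - 5 * (y - x) := by
    intro x y h0 h1 h2
    have e : y + -(y - x) = x := by ring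
    have h3 := hadd y (-(y - x)) (by
      rw [e, h2, S.neg_eq (by linarith) (by linarith)]; ring)
    rw [e, hdown0 (y - x) (by linarith) (by linarith)] at h3
    linarith
  -- the values at the ends of the zigzags
  have a0 := (S.zigzagEnd ht ht' (s := 3/20) (.inl rfl)).2.2
  have a1 := (S.zigzagEnd ht ht' (s := 3/20 + t) (.inr (.inl rfl))).2.2
  have a2 := (S.zigzagEnd ht ht' (s := 7/40) (.inr (.inr rfl))).2.2
  have k1 := hup (3/20) (3/20 + 2*t/3) (by linarith) (by linarith) (by
    rw [a0, S.s3 _ (by linarith) le_rfl])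
  have k2 := hdown (3/20 + 2*t/3) (3/20 + t) (by linarith) (by linarith) (by
    rw [a1, S.s3 _ (by linarith) le_rfl]; ring)
  have k3 := hup (3/20 + t) (1/6 + t/3) (by linarith) (by linarith) (by
    rw [a1, S.s5 _ (by linarith) le_rfl])
  have k4 := hdown (1/6 + t/3) (7/40) (by linarith) (by linarith) (by
    rw [a2, S.s5 _ (by linarith) le_rfl]; ring)
  -- `θ` is affine on the first interval of slope zero
  set s := (2 * κ - 5) / 3 with hs
  have hA : ∀ a x, IsZigzagEnd t a → 3/10 ≤ x → x ≤ 7/20 → a + x ≤ 1/2 →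
      θ (a + x) = θ a + θ x := by
    intro a x ha h0 h1 h2
    have ha' := S.zigzagEnd ht ht' ha
    refine hadd a x ?_
    rw [ha'.2.2, S.s9 x h0 h1, S.s11 _ (by linarith [ha'.1]) h2]
    norm_num
  have haff : ∀ x, 3/10 ≤ x → x ≤ 7/20 → θ x = θ (3/10) + s * (x - 3/10) := by
    intro x h0 h1
    have hcont : Continuous fun x => θ x - s * x := by
      have := hlip.continuous
      fun_prop
    have := const_of_two_periods (a := 3/10) (b := 7/20) hcont ht (t := 1/40) (by norm_num)
      (by linarith) (by
        have := (irrational_mul_natCast_iff (n := 40) (x := t)).mpr ⟨by norm_num, hirr⟩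
        convert this using 1
        push_cast
        ring) (fun x h0 h1 => by
          -- One point is reached in two ways, as `(3/20 + t) + x` and as `3/20 + (x + t)`. The
          -- zigzag of length `t` changes `θ` by `κ * (2*t/3) - 5 * (t/3) = s * t`, so `θ x - s * x`
          -- has period `t`.
          have e1 := hA (3/20 + t) x (.inr (.inl rfl)) h0 (by linarith) (by linarith)
          have e2 := hA (3/20) (x + t) (.inl rfl) (by linarith) (by linarith) (by linarith)
          rw [show 3/20 + (x + t) = 3/20 + t + x by ring] at e2
          rw [hs]
          linarith) (fun x h0 h1 => by
          have e1 := hA (7/40) x (.inr (.inr rfl)) h0 (by linarith) (by linarith)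
          have e2 := hA (3/20) (x + 1/40) (.inl rfl) (by linarith) (by linarith) (by linarith)
          rw [show 3/20 + (x + 1/40) = 7/40 + x by ring] at e2
          rw [hs]
          linarith) (x := x) (y := 3/10) h0 h1 le_rfl (by norm_num)
    linarith
  -- the slope `κ` is determined by the value at the centre of symmetry
  have n1 := hup0 (2/15) (by norm_num) le_rfl
  have n2 := hdown (2/15) (3/20) (by norm_num) (by norm_num) (by
    rw [a0, S.s1 _ (by norm_num) le_rfl]; norm_num)
  have n3 := hup (7/40) (11/40) (by norm_num) (by norm_num) (by
    rw [a2, S.s7 _ (by norm_num) le_rfl])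
  have n4 := hdown (11/40) (3/10) (by norm_num) (by norm_num) (by
    rw [S.s8 _ le_rfl (by norm_num), S.s8 _ (by norm_num) le_rfl]; norm_num)
  have n5 := haff (7/20) (by norm_num) le_rfl
  have n6 := hup (7/20) (2/5) (by norm_num) (by norm_num) (by
    rw [S.s10 _ le_rfl (by norm_num), S.s10 _ (by norm_num) (by norm_num)]; norm_num)
  have n7 : θ (2/5) = 1/2 := by
    have := hsym (2/5)
    norm_num at this
    linarith
  -- The increments from `0` to `2/5` add up to `κ/3 - 1/3`, which must be `1/2`.
  have hκv : κ = 5/2 := by linarith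
  have hsv : s = 0 := by linarith
  clear_value κ s
  subst hκv hsv
  exact S.eq_of_slopes ht ht' hsym hper hup0 hdown0 hup hdown haff

theorem isExtreme (S : Shape t (fun _ => 0) g) (ht : 0 < t) (ht' : t < 1/40)
    (hirr : Irrational t) : IsExtreme (4/5) g := by
  have hv := S.isValid (isPerturbation_zero t) ht ht'
  have main : ∀ θ θ' : ℝ → ℝ, IsValid (4/5) θ → IsValid (4/5) θ' →
      (∀ x, g x = (θ x + θ' x) / 2) → θ = g := by
    intro θ θ' h h' hav
    have hav' : ∀ x, g x = (θ' x + θ x) / 2 := fun x => by rw [hav, add_comm]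
    have hsym := h.symmetric_of_average h' hav S.symmetric
    have hsym' := h'.symmetric_of_average h hav' S.symmetric
    have hsub := h.subadditive_of_symmetric hsym
    exact S.eq_of_additive ht ht' hirr h.1 (fun x => by linarith [hav x, h'.1 x]) hsym hsub
      (h.periodic_of_symmetric hsym)
      (fun x y => additive_of_average hsub (h'.subadditive_of_symmetric hsym') hav)
  refine ⟨hv, fun θ θ' h h' hav => ⟨main θ θ' h h' hav, main θ' θ h' h fun x => ?_⟩⟩
  rw [hav, add_comm]

end Shape

/-! ## The functions of type `bhk_irrational` -/

/-- The parameters of the family under consideration. -/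
noncomputable def zigzagParams (t : ℝ) : BHKParams := ⟨4/5, 3/5, 1/10, 3/20, t, 1/40 - t⟩

theorem zigzagParams_d1 (t : ℝ) : (zigzagParams t).d1 = 3/5 := rfl
theorem zigzagParams_d2 (t : ℝ) : (zigzagParams t).d2 = 1/10 := rfl
theorem zigzagParams_a0 (t : ℝ) : (zigzagParams t).a0 = 3/20 := rfl

theorem zigzagParams_d3 (t : ℝ) : (zigzagParams t).d3 = 1/10 := by
  simp only [BHKParams.d3, zigzagParams]; norm_num

theorem zigzagParams_c3 (t : ℝ) : (zigzagParams t).c3 = -5 := by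
  simp only [BHKParams.c3, zigzagParams]; norm_num

theorem zigzagParams_c1 (t : ℝ) : (zigzagParams t).c1 = 5/2 := by
  simp only [BHKParams.c1, zigzagParams_c3, zigzagParams_d3, BHKParams.c2, zigzagParams_d1]; norm_num

theorem zigzagParams_zneg (t δ : ℝ) : (zigzagParams t).zneg δ = δ/3 := by
  simp only [BHKParams.zneg, zigzagParams_c1, zigzagParams_c3]; ring

theorem zigzagParams_zpos (t δ : ℝ) : (zigzagParams t).zpos δ = 2*δ/3 := by
  simp only [BHKParams.zpos, zigzagParams_zneg]; ring

theorem zigzagParams_left (t : ℝ) : (zigzagParams t).left =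
    [(2/15, 5/2), (1/60, -5), (2*t/3, 5/2), (t/3, -5), (1/60 - 2*t/3, 5/2), (1/120 - t/3, -5),
      (1/10, 5/2), (1/40, -5), (1/20, 0)] := by
  have h21 : (zigzagParams t).d21 = 1/20 := by simp only [BHKParams.d21, zigzagParams_d2]; norm_num
  have h31 : (zigzagParams t).d31 = 1/60 := by
    simp only [BHKParams.d31, h21, zigzagParams_c1, zigzagParams_c3]; norm_num
  have h11 : (zigzagParams t).d11 = 2/15 := by
    simp only [BHKParams.d11, h31, zigzagParams_a0]; norm_num
  have h12 : (zigzagParams t).d12 = 7/60 := by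
    simp only [BHKParams.d12, h11, BHKParams.d13, h21, zigzagParams_a0,
      zigzagParams_d1]; norm_num
  have h32 : (zigzagParams t).d32 = 1/30 := by
    simp only [BHKParams.d32, h31, zigzagParams_d3]; norm_num
  have e1 : (zigzagParams t).δ1 = t := rfl
  have e2 : (zigzagParams t).δ2 = 1/40 - t := rfl
  simp only [BHKParams.left, h11, h12, h21, h31, h32, e1, e2, zigzagParams_zneg,
    zigzagParams_zpos, zigzagParams_c1, zigzagParams_c3, BHKParams.c2, List.cons.injEq,
    Prod.mk.injEq, and_true, true_and]
  refine ⟨?_, ?_, ?_, ?_⟩ <;> ring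

theorem zigzagParams_segments (t : ℝ) : (zigzagParams t).segments =
    [(2/15, 5/2), (1/60, -5), (2*t/3, 5/2), (t/3, -5), (1/60 - 2*t/3, 5/2), (1/120 - t/3, -5),
      (1/10, 5/2), (1/40, -5), (1/20, 0), (1/10, 5/2), (1/20, 0), (1/40, -5), (1/10, 5/2),
      (1/120 - t/3, -5), (1/60 - 2*t/3, 5/2), (t/3, -5), (2*t/3, 5/2), (1/60, -5), (2/15, 5/2),
      (1/5, -5)] := by
  have h13 : (zigzagParams t).d13 = 1/10 := by
    simp only [BHKParams.d13, BHKParams.d21, zigzagParams]; norm_num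
  have hf : 1 - (zigzagParams t).f = 1/5 := by simp only [zigzagParams]; norm_num
  simp only [BHKParams.segments, zigzagParams_left, h13, hf, zigzagParams_c1, zigzagParams_c3,
    List.reverse_cons, List.reverse_nil, List.nil_append, List.cons_append]

theorem zigzagParams_admissible {t : ℝ} (ht : 0 < t) (ht' : t < 1/40) :
    (zigzagParams t).Admissible where
  f_pos := by simp only [zigzagParams]; norm_num
  f_lt_one := by simp only [zigzagParams]; norm_num
  d1_pos := by simp only [zigzagParams]; norm_num
  d2_pos := by simp only [zigzagParams]; norm_num
  d3_pos := by simp only [zigzagParams]; norm_num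
  a0_pos := by simp only [zigzagParams]; norm_num
  δ1_pos := ht
  δ2_pos := sub_pos.mpr ht'
  length_pos := by
    rw [zigzagParams_segments]
    simp only [List.forall_mem_cons, List.not_mem_nil, false_imp_iff, implies_true, and_true]
    refine ⟨?_, ?_, ?_, ?_, ?_, ?_, ?_, ?_, ?_, ?_, ?_, ?_, ?_, ?_, ?_, ?_, ?_, ?_, ?_, ?_⟩ <;>
    linarith

/-! ### Evaluation of piecewise linear functions -/

theorem plFun_cons_of_le {l c x : ℝ} {L : List (ℝ × ℝ)} (h : x ≤ l) :
    plFun ((l, c) :: L) x = c * x := by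
  simp [plFun, h]

theorem plFun_zero {L : List (ℝ × ℝ)} (hL : ∀ s ∈ L, 0 < s.1) : plFun L 0 = 0 := by
  cases L with
  | nil => rfl
  | cons s L => simp [plFun, (hL s (by simp)).le]

theorem plFun_cons_of_ge {l c x : ℝ} {L : List (ℝ × ℝ)} (hL : ∀ s ∈ L, 0 < s.1) (h : l ≤ x) :
    plFun ((l, c) :: L) x = c * l + plFun L (x - l) := by
  rcases h.eq_or_lt with rfl | h
  · simp [plFun, plFun_zero hL]
  · simp [plFun, not_le.mpr h]

/-- Evaluation of a piecewise linear function after the first interval of the rest. -/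
theorem plFun_step {F : ℝ → ℝ} {b b' v v' l c : ℝ} {L : List (ℝ × ℝ)}
    (hF : ∀ x, b ≤ x → F x = v + plFun ((l, c) :: L) (x - b))
    (hpos : ∀ s ∈ (l, c) :: L, 0 < s.1) (hb : b' = b + l) (hv : v' = v + c * l) :
    (∀ x, b ≤ x → x ≤ b' → F x = v + c * (x - b)) ∧
      (∀ x, b' ≤ x → F x = v' + plFun L (x - b')) ∧ ∀ s ∈ L, 0 < s.1 := by
  have hl : 0 < l := hpos (l, c) (by simp)
  have hL : ∀ s ∈ L, 0 < s.1 := fun s hs => hpos s (by simp [hs])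
  refine ⟨fun x h0 h1 => ?_, fun x h0 => ?_, hL⟩
  · rw [hF x h0, plFun_cons_of_le (by linarith)]
  · rw [hF x (by linarith), plFun_cons_of_ge hL (by linarith), hb, hv, ← sub_sub, add_assoc]

theorem toFun_shape {t : ℝ} (ht : 0 < t) (ht' : t < 1/40) :
    Shape t (fun _ => 0) (zigzagParams t).toFun := by
  have hpos := (zigzagParams_admissible ht ht').length_pos
  have hfun : ∀ x, (zigzagParams t).toFun x = plFun (zigzagParams t).segments (Int.fract x) :=
    fun _ => rfl
  rw [zigzagParams_segments] at hpos
  simp only [zigzagParams_segments] at hfun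
  generalize hF : plFun _ = F at hfun
  have k0 : ∀ x, 0 ≤ x → F x = 0 + plFun _ (x - 0) := fun x _ => by
    rw [zero_add, sub_zero, ← hF]
  obtain ⟨p1, k1, q1⟩ := plFun_step (b' := 2/15) (v' := 1/3) k0 hpos
    (by ring) (by ring)
  obtain ⟨p2, k2, q2⟩ := plFun_step (b' := 3/20) (v' := 1/4) k1 q1
    (by ring) (by ring)
  obtain ⟨p3, k3, q3⟩ := plFun_step (b' := 3/20 + 2*t/3) (v' := 1/4 + 5*t/3) k2 q2
    (by ring) (by ring)
  obtain ⟨p4, k4, q4⟩ := plFun_step (b' := 3/20 + t) (v' := 1/4) k3 q3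
    (by ring) (by ring)
  obtain ⟨p5, k5, q5⟩ := plFun_step (b' := 1/6 + t/3) (v' := 1/4 + 5/2*(1/60 - 2*t/3)) k4 q4
    (by ring) (by ring)
  obtain ⟨p6, k6, q6⟩ := plFun_step (b' := 7/40) (v' := 1/4) k5 q5
    (by ring) (by ring)
  obtain ⟨p7, k7, q7⟩ := plFun_step (b' := 11/40) (v' := 1/2) k6 q6
    (by ring) (by ring)
  obtain ⟨p8, k8, q8⟩ := plFun_step (b' := 3/10) (v' := 3/8) k7 q7
    (by ring) (by ring)
  obtain ⟨p9, k9, q9⟩ := plFun_step (b' := 7/20) (v' := 3/8) k8 q8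
    (by ring) (by ring)
  obtain ⟨p10, k10, q10⟩ := plFun_step (b' := 9/20) (v' := 5/8) k9 q9
    (by ring) (by ring)
  obtain ⟨p11, k11, q11⟩ := plFun_step (b' := 1/2) (v' := 5/8) k10 q10
    (by ring) (by ring)
  obtain ⟨p12, k12, q12⟩ := plFun_step (b' := 21/40) (v' := 1/2) k11 q11
    (by ring) (by ring)
  obtain ⟨p13, k13, q13⟩ := plFun_step (b' := 5/8) (v' := 3/4) k12 q12
    (by ring) (by ring)
  obtain ⟨p14, k14, q14⟩ := plFun_step (b' := 19/30 - t/3) (v' := 3/4 - 5*(1/120 - t/3)) k13 q13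
    (by ring) (by ring)
  obtain ⟨p15, k15, q15⟩ := plFun_step (b' := 13/20 - t) (v' := 3/4) k14 q14
    (by ring) (by ring)
  obtain ⟨p16, k16, q16⟩ := plFun_step (b' := 13/20 - 2*t/3) (v' := 3/4 - 5*t/3) k15 q15
    (by ring) (by ring)
  obtain ⟨p17, k17, q17⟩ := plFun_step (b' := 13/20) (v' := 3/4) k16 q16
    (by ring) (by ring)
  obtain ⟨p18, k18, q18⟩ := plFun_step (b' := 2/3) (v' := 2/3) k17 q17
    (by ring) (by ring)
  obtain ⟨p19, k19, q19⟩ := plFun_step (b' := 4/5) (v' := 1) k18 q18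
    (by ring) (by ring)
  obtain ⟨p20, k20, q20⟩ := plFun_step (b' := 1) (v' := 0) k19 q19
    (by ring) (by ring)
  have hF' : ∀ x, 0 ≤ x → x ≤ 1 → (zigzagParams t).toFun x = F x := by
    intro x h0 h1
    -- At `1` the fractional part is `0`, so closing the last interval uses that `F` has the same
    -- value `0` at both ends.
    rcases h1.eq_or_lt with rfl | h1
    · rw [hfun, Int.fract_one, p1 0 le_rfl (by norm_num), p20 1 (by norm_num) le_rfl]
      norm_num
    · rw [hfun, Int.fract_eq_self.mpr ⟨h0, h1⟩]
  refine ⟨fun x => by rw [hfun, hfun, Int.fract_add_one], ?_, ?_, ?_, ?_, ?_, ?_, ?_, ?_, ?_, ?_,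
    ?_, ?_, ?_, ?_, ?_, ?_, ?_, ?_, ?_, ?_⟩ <;> intro x h0 h1 <;>
    rw [hF' x (by linarith) (by linarith)]
  · rw [p1 x h0 h1]; ring
  · rw [p2 x h0 h1]; ring
  · rw [p3 x h0 h1]
  · rw [p4 x h0 h1]; ring
  · rw [p5 x h0 h1]
  · rw [p6 x h0 h1]; ring
  · rw [p7 x h0 h1]
  · rw [p8 x h0 h1]; ring
  · rw [p9 x h0 h1]; ring
  · rw [p10 x h0 h1]
  · rw [p11 x h0 h1]; ring
  · rw [p12 x h0 h1]; ring
  · rw [p13 x h0 h1]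
  · rw [p14 x h0 h1]; ring
  · rw [p15 x h0 h1]; ring
  · rw [p16 x h0 h1]; ring
  · rw [p17 x h0 h1]; ring
  · rw [p18 x h0 h1]; ring
  · rw [p19 x h0 h1]; ring
  · rw [p20 x h0 h1]; ring

/-! ## The perturbation in the commensurable case -/

/-- A function supported on the intervals of slope zero. -/
noncomputable def ripple (ε x : ℝ) : ℝ :=
  if (3/10 ≤ Int.fract x ∧ Int.fract x ≤ 7/20) ∨ (9/20 ≤ Int.fract x ∧ Int.fract x ≤ 1/2) then
    -- The sine has period `1/80`, which divides `1/40`, and it vanishes at all four ends of the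
    -- flat pieces.
    ε * Real.sin (160 * Real.pi * x) else 0

theorem ripple_of_mem {ε x : ℝ} (h : (3/10 ≤ x ∧ x ≤ 7/20) ∨ (9/20 ≤ x ∧ x ≤ 1/2)) :
    ripple ε x = ε * Real.sin (160 * Real.pi * x) := by
  have : Int.fract x = x := by
    rw [Int.fract_eq_self]
    rcases h with h | h <;> constructor <;> linarith [h.1, h.2]
  rw [ripple, this, if_pos h]

/-- The closed regions overlap the closed support in the points `3/10`, `7/20`, `9/20` and `1/2`,
where the argument of the sine is `48`, `56`, `72` and `80` times `π`. -/
theorem ripple_eq_zero {ε x : ℝ} (h0 : 0 ≤ x) (h1 : x ≤ 1)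
    (h : x ≤ 3/10 ∨ (7/20 ≤ x ∧ x ≤ 9/20) ∨ 1/2 ≤ x) : ripple ε x = 0 := by
  rcases h1.eq_or_lt with rfl | h1
  · rw [ripple, Int.fract_one, if_neg (by norm_num)]
  have hfr : Int.fract x = x := Int.fract_eq_self.mpr ⟨h0, h1⟩
  have hs : ∀ (k : ℕ) {y : ℝ}, 160 * y = k → ε * Real.sin (160 * Real.pi * y) = 0 := by
    intro k y hy
    rw [mul_right_comm, hy, Real.sin_nat_mul_pi, mul_zero]
  rw [ripple, hfr]
  split_ifs with hm
  · rcases h with h | h | h <;> rcases hm with hm | hm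
    · exact hs 48 (by push_cast; linarith [hm.1])
    · linarith [hm.1]
    · exact hs 56 (by push_cast; linarith [hm.2, h.1])
    · exact hs 72 (by push_cast; linarith [hm.1, h.2])
    · linarith [hm.2]
    · exact hs 80 (by push_cast; linarith [hm.2])
  · rfl

theorem ripple_periodic (ε : ℝ) : Function.Periodic (ripple ε) 1 := by
  intro x
  have : Real.sin (160 * Real.pi * (x + 1)) = Real.sin (160 * Real.pi * x) := by
    rw [← Real.sin_add_nat_mul_two_pi (160 * Real.pi * x) 80]
    congr 1
    push_cast
    ring
  rw [ripple, ripple, Int.fract_add_one, this]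

theorem isPerturbation_sin {ε : ℝ} (hε : |ε| ≤ 1/1000) :
    IsPerturbation (1/80) fun x => ε * Real.sin (160 * Real.pi * x) where
  per_t x := by
    congr 1
    rw [← Real.sin_add_two_pi (160 * Real.pi * x)]
    congr 1
    ring
  per_d x := by
    congr 1
    rw [← Real.sin_add_nat_mul_two_pi (160 * Real.pi * x) 2]
    congr 1
    push_cast
    ring
  odd x := by
    rw [← mul_neg, ← Real.sin_neg, ← Real.sin_add_nat_mul_two_pi (-(160 * Real.pi * x)) 52]
    congr 2
    push_cast
    ring
  lip x y := by
    rw [← mul_sub, abs_mul]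
    have h1 : |Real.sin (160 * Real.pi * x) - Real.sin (160 * Real.pi * y)| ≤
        160 * Real.pi * |x - y| := by
      have := Real.lipschitzWith_sin.dist_le_mul (160 * Real.pi * x) (160 * Real.pi * y)
      rw [Real.dist_eq, Real.dist_eq, ← mul_sub, abs_mul,
        abs_of_pos (show 0 < 160 * Real.pi by positivity)] at this
      simpa using this
    have h2 := Real.pi_lt_four
    -- With `π < 4` the Lipschitz constant is below `0.64`.
    calc |ε| * _ ≤ 1/1000 * (160 * Real.pi * |x - y|) := by gcongr
      _ ≤ 5/2 * |x - y| := by nlinarith [abs_nonneg (x - y)]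
  bound x := by
    rw [abs_mul]
    calc |ε| * _ ≤ 1/1000 * 1 := by gcongr; exact Real.abs_sin_le_one _
      _ ≤ 1/24 := by norm_num
  zero := by
    rw [show 160 * Real.pi * (3/10) = (48 : ℕ) * Real.pi by push_cast; ring, Real.sin_nat_mul_pi,
      mul_zero]

theorem Shape.add_ripple {g : ℝ → ℝ} (S : Shape (1/80) (fun _ => 0) g) (ε : ℝ) :
    Shape (1/80) (fun x => ε * Real.sin (160 * Real.pi * x)) fun x => g x + ripple ε x where
  per := S.per.add (ripple_periodic ε)
  s1 x h0 h1 := by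
    rw [S.s1 x h0 h1, ripple_eq_zero (by linarith) (by linarith) (.inl (by linarith)), add_zero]
  s2 x h0 h1 := by
    rw [S.s2 x h0 h1, ripple_eq_zero (by linarith) (by linarith) (.inl (by linarith)), add_zero]
  s3 x h0 h1 := by
    rw [S.s3 x h0 h1, ripple_eq_zero (by linarith) (by linarith) (.inl (by linarith)), add_zero]
  s4 x h0 h1 := by
    rw [S.s4 x h0 h1, ripple_eq_zero (by linarith) (by linarith) (.inl (by linarith)), add_zero]
  s5 x h0 h1 := by
    rw [S.s5 x h0 h1, ripple_eq_zero (by linarith) (by linarith) (.inl (by linarith)), add_zero]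
  s6 x h0 h1 := by
    rw [S.s6 x h0 h1, ripple_eq_zero (by linarith) (by linarith) (.inl (by linarith)), add_zero]
  s7 x h0 h1 := by
    rw [S.s7 x h0 h1, ripple_eq_zero (by linarith) (by linarith) (.inl (by linarith)), add_zero]
  s8 x h0 h1 := by
    rw [S.s8 x h0 h1, ripple_eq_zero (by linarith) (by linarith) (.inl (by linarith)), add_zero]
  s9 x h0 h1 := by rw [S.s9 x h0 h1, ripple_of_mem (.inl ⟨h0, h1⟩)]; ring
  s10 x h0 h1 := by
    rw [S.s10 x h0 h1, ripple_eq_zero (by linarith) (by linarith) (.inr (.inl ⟨h0, h1⟩)), add_zero]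
  s11 x h0 h1 := by
    -- The shift `3/20` is twelve periods, so one sine serves both flat pieces.
    have : Real.sin (160 * Real.pi * (x - 3/20)) = Real.sin (160 * Real.pi * x) := by
      rw [← Real.sin_sub_nat_mul_two_pi (160 * Real.pi * x) 12]
      congr 1
      push_cast
      ring
    rw [S.s11 x h0 h1, ripple_of_mem (.inr ⟨h0, h1⟩), this]; ring
  s12 x h0 h1 := by
    rw [S.s12 x h0 h1, ripple_eq_zero (by linarith) (by linarith) (.inr (.inr (by linarith))), add_zero]
  s13 x h0 h1 := by
    rw [S.s13 x h0 h1, ripple_eq_zero (by linarith) (by linarith) (.inr (.inr (by linarith))), add_zero]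
  s14 x h0 h1 := by
    rw [S.s14 x h0 h1, ripple_eq_zero (by linarith) (by linarith) (.inr (.inr (by linarith))), add_zero]
  s15 x h0 h1 := by
    rw [S.s15 x h0 h1, ripple_eq_zero (by linarith) (by linarith) (.inr (.inr (by linarith))), add_zero]
  s16 x h0 h1 := by
    rw [S.s16 x h0 h1, ripple_eq_zero (by linarith) (by linarith) (.inr (.inr (by linarith))), add_zero]
  s17 x h0 h1 := by
    rw [S.s17 x h0 h1, ripple_eq_zero (by linarith) (by linarith) (.inr (.inr (by linarith))), add_zero]
  s18 x h0 h1 := by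
    rw [S.s18 x h0 h1, ripple_eq_zero (by linarith) (by linarith) (.inr (.inr (by linarith))), add_zero]
  s19 x h0 h1 := by
    rw [S.s19 x h0 h1, ripple_eq_zero (by linarith) (by linarith) (.inr (.inr (by linarith))), add_zero]
  s20 x h0 h1 := by
    rw [S.s20 x h0 h1, ripple_eq_zero (by linarith) (by linarith) (.inr (.inr (by linarith))), add_zero]

/-- `g` is the average of its perturbations by a ripple and by the opposite ripple, both valid. -/
theorem Shape.not_isExtreme {g : ℝ → ℝ} (S : Shape (1/80) (fun _ => 0) g) :
    ¬ IsExtreme (4/5) g := by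
  rintro ⟨-, hext⟩
  have hv : ∀ ε : ℝ, |ε| ≤ 1/1000 → IsValid (4/5) fun x => g x + ripple ε x := fun ε hε =>
    (S.add_ripple ε).isValid (isPerturbation_sin hε) (by norm_num) (by norm_num)
  have hneg : ∀ x, ripple (-(1/1000)) x = - ripple (1/1000) x := by
    intro x
    simp only [ripple]
    split_ifs <;> ring
  obtain ⟨h1, -⟩ := hext _ _ (hv (1/1000) (by norm_num)) (hv (-(1/1000)) (by norm_num))
    (fun x => by rw [hneg]; ring)
  -- A quarter period after a zero, where the sine is `1`.
  have h2 := congrFun h1 (3/10 + 1/320)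
  rw [ripple_of_mem (.inl (by norm_num)), show 160 * Real.pi * (3/10 + 1/320) =
    Real.pi / 2 + (24 : ℕ) * (2 * Real.pi) by push_cast; ring, Real.sin_add_nat_mul_two_pi,
    Real.sin_pi_div_two] at h2
  linarith

/-! ## Weak derivatives and convergence -/

theorem locallyIntegrable_deriv_of_lipschitz {u : ℝ → ℝ} {K : NNReal} (hu : LipschitzWith K u) :
    LocallyIntegrable (deriv u) volume :=
  (locallyIntegrable_const (K : ℝ)).mono (measurable_deriv u).aestronglyMeasurable
    (Eventually.of_forall fun x => by
      simpa using norm_deriv_le_of_lipschitz hu (x₀ := x))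

/-- Lipschitz functions are absolutely continuous, so integration by parts holds on an interval
around the support of the test function, with vanishing boundary terms. -/
theorem hasWeakDeriv_deriv_of_lipschitz {u : ℝ → ℝ} {K : NNReal} (hu : LipschitzWith K u) :
    HasWeakDeriv u (deriv u) := by
  refine ⟨hu.continuous.locallyIntegrable, locallyIntegrable_deriv_of_lipschitz hu, ?_⟩
  intro φ hφ hφc
  obtain ⟨R, hR, hsupp⟩ := hφc.isCompact.isBounded.subset_ball_lt 0 0
  rw [Real.ball_eq_Ioo, zero_sub, zero_add] at hsupp
  have hzero : ∀ x, x ∉ Set.Ioo (-R) R → φ x = 0 := fun x hx =>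
    image_eq_zero_of_notMem_tsupport fun h => hx (hsupp h)
  have hzero' : ∀ x, x ∉ Set.Ioo (-R) R → deriv φ x = 0 := fun x hx =>
    image_eq_zero_of_notMem_tsupport fun h => hx (hsupp (tsupport_deriv_subset h))
  have hle : -R ≤ R := by linarith
  have restrict : ∀ w : ℝ → ℝ, (∀ x, x ∉ Set.Ioo (-R) R → w x = 0) →
      ∫ x, w x = ∫ x in (-R)..R, w x := by
    intro w hw
    rw [intervalIntegral.integral_of_le hle]
    exact (setIntegral_eq_integral_of_forall_compl_eq_zero fun x hx =>
      hw x fun h => hx (Set.Ioo_subset_Ioc_self h)).symm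
  rw [restrict _ fun x hx => by rw [hzero' x hx, mul_zero],
    restrict _ fun x hx => by rw [hzero x hx, mul_zero],
    AbsolutelyContinuousOnInterval.integral_mul_deriv_eq_deriv_mul
      hu.lipschitzOnWith.absolutelyContinuousOnInterval
      (ContDiffOn.absolutelyContinuousOnInterval (hφ.of_le (by simp)).contDiffOn),
    hzero R (by simp), hzero (-R) (by simp)]
  ring

/-- Boundedly dominated convergence almost everywhere implies convergence in `L¹_loc`. -/
theorem tendstoL1Loc_of_dominated {u : ℕ → ℝ → ℝ} {w : ℝ → ℝ} {C : ℝ}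
    (hu : ∀ n, LocallyIntegrable (u n) volume) (hw : LocallyIntegrable w volume)
    (hC : ∀ n x, |u n x - w x| ≤ C)
    (hlim : ∀ᵐ x, Tendsto (fun n => u n x) atTop (𝓝 (w x))) : TendstoL1Loc u w := by
  refine ⟨hu, hw, fun K hK => ?_⟩
  have : Tendsto (fun n => ∫ x in K, |u n x - w x|) atTop (𝓝 (∫ _ in K, (0 : ℝ))) := by
    refine tendsto_integral_of_dominated_convergence (fun _ => C) (fun n => ?_) ?_ (fun n => ?_) ?_
    · exact ((hu n).aestronglyMeasurable.sub hw.aestronglyMeasurable).norm.restrict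
    · exact integrableOn_const hK.measure_lt_top.ne
    · exact Eventually.of_forall fun x => by simpa using hC n x
    · refine ae_restrict_of_ae (hlim.mono fun x hx => ?_)
      simpa using (hx.sub_const (w x)).abs
  simpa using this

theorem deriv_eq_of_affine {g : ℝ → ℝ} {a b c v w x : ℝ}
    (hg : ∀ x, a ≤ x → x ≤ b → g x = v + c * (x - w)) (h0 : a < x) (h1 : x < b) :
    deriv g x = c := by
  have : g =ᶠ[𝓝 x] fun y => v + c * (y - w) :=
    eventually_of_mem (Ioo_mem_nhds h0 h1) fun y hy => hg y hy.1.le hy.2.le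
  rw [this.deriv_eq]
  simp [deriv_const_add]

theorem deriv_fract_of_periodic {g : ℝ → ℝ} (hg : Function.Periodic g 1) (x : ℝ) :
    deriv g (Int.fract x) = deriv g x := by
  have h : (fun y => g (y - ⌊x⌋)) = g := by
    funext y
    have := hg.sub_int_mul_eq ⌊x⌋ (x := y)
    rwa [mul_one] at this
  conv_rhs => rw [← h]
  rw [deriv_comp_sub_const]
  rfl

theorem ae_fract_notMem {B : Set ℝ} (hB : B.Countable) : ∀ᵐ x : ℝ, Int.fract x ∉ B := by
  have hsub : {x : ℝ | Int.fract x ∈ B} ⊆ (fun q : ℝ × ℤ => q.1 + q.2) '' (B ×ˢ Set.univ) :=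
    fun x hx => ⟨(Int.fract x, ⌊x⌋), ⟨hx, Set.mem_univ _⟩, Int.fract_add_floor x⟩
  have : {x : ℝ | Int.fract x ∈ B}.Countable :=
    ((hB.prod Set.countable_univ).image _).mono hsub
  simpa [ae_iff] using this.measure_zero volume

/-! ### Dependence on the zigzag parameter -/

namespace Shape

variable {t t' : ℝ} {g g' : ℝ → ℝ}

theorem lipschitz (S : Shape t (fun _ => 0) g) (ht : 0 < t) (ht' : t < 1/40) :
    LipschitzWith 5 g := by
  refine LipschitzWith.of_dist_le_mul fun x y => ?_
  rw [Real.dist_eq, Real.dist_eq, abs_le]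
  push_cast
  have H := isPerturbation_zero t
  rcases le_total x y with h | h
  · have := S.slope H ht ht' h
    rw [abs_of_nonpos (by linarith)]
    constructor <;> linarith [this.1, this.2]
  · have := S.slope H ht ht' h
    rw [abs_of_nonneg (by linarith)]
    constructor <;> linarith [this.1, this.2]

/-- Two functions of the family differ only on the zigzags. -/
theorem eq_of_not_zigzag (S : Shape t (fun _ => 0) g) (S' : Shape t' (fun _ => 0) g')
    (ht : 0 < t) (ht' : t < 1/40) {x : ℝ} (h0 : 0 ≤ x) (h1 : x ≤ 1)
    (h : x < 3/20 ∨ (7/40 < x ∧ x < 5/8) ∨ 13/20 < x) : g x = g' x := by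
  rcases S.cases h0 h1 with e | e | e | e | e | e | e | e | e | e | e | e | e | e | e | e | e | e |
    e | e <;> obtain ⟨e1, e2, e⟩ := e
  · rw [e, S'.s1 x e1 e2]
  · rw [e, S'.s2 x e1 e2]
  · exfalso; rcases h with h | h | h <;> linarith
  · exfalso; rcases h with h | h | h <;> linarith
  · exfalso; rcases h with h | h | h <;> linarith
  · exfalso; rcases h with h | h | h <;> linarith
  · rw [e, S'.s7 x e1 e2]
  · rw [e, S'.s8 x e1 e2]
  · rw [e, S'.s9 x e1 e2]
  · rw [e, S'.s10 x e1 e2]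
  · rw [e, S'.s11 x e1 e2]
  · rw [e, S'.s12 x e1 e2]
  · rw [e, S'.s13 x e1 e2]
  · exfalso; rcases h with h | h | h <;> linarith
  · exfalso; rcases h with h | h | h <;> linarith
  · exfalso; rcases h with h | h | h <;> linarith
  · exfalso; rcases h with h | h | h <;> linarith
  · rw [e, S'.s18 x e1 e2]
  · rw [e, S'.s19 x e1 e2]
  · rw [e, S'.s20 x e1 e2]

/-- Each formula on the zigzags changes with `t` at rate at most `5`; the constant `10` is generous.
Stating the bound with `d` in place of `|t - t'|` leaves linear inequalities on every pair of
pieces. -/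
theorem le_add_mul (S : Shape t (fun _ => 0) g) (S' : Shape t' (fun _ => 0) g')
    (ht : 0 < t) (ht' : t < 1/40) (hs : 0 < t') (hs' : t' < 1/40) {d x : ℝ} (hd : t - t' ≤ d)
    (hd' : t' - t ≤ d) (h0 : 0 ≤ x) (h1 : x ≤ 1) : g x ≤ g' x + 10 * d := by
  by_cases h : x < 3/20 ∨ (7/40 < x ∧ x < 5/8) ∨ 13/20 < x
  · rw [S.eq_of_not_zigzag S' ht ht' h0 h1 h]; linarith
  have h' : (3/20 ≤ x ∧ x ≤ 7/40) ∨ (5/8 ≤ x ∧ x ≤ 13/20) := by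
    push Not at h
    rcases le_or_gt x (7/40) with e | e
    · exact .inl ⟨h.1, e⟩
    · exact .inr ⟨h.2.1 e, h.2.2⟩
  clear h
  rcases h' with ⟨l0, l4⟩ | ⟨l0, l4⟩
  · have e : ∀ {s : ℝ} {k : ℝ → ℝ}, Shape s (fun _ => 0) k →
        (x ≤ 3/20 + 2*s/3 ∧ k x = 1/4 + 5/2 * (x - 3/20)) ∨
        (3/20 + 2*s/3 ≤ x ∧ x ≤ 3/20 + s ∧ k x = 1/4 - 5 * (x - (3/20 + s))) ∨
        (3/20 + s ≤ x ∧ x ≤ 1/6 + s/3 ∧ k x = 1/4 + 5/2 * (x - (3/20 + s))) ∨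
        (1/6 + s/3 ≤ x ∧ k x = 1/4 - 5 * (x - 7/40)) := by
      intro s k K
      rcases le_total x (3/20 + 2*s/3) with l1 | l1
      · exact .inl ⟨l1, K.s3 x l0 l1⟩
      rcases le_total x (3/20 + s) with l2 | l2
      · exact .inr (.inl ⟨l1, l2, K.s4 x l1 l2⟩)
      rcases le_total x (1/6 + s/3) with l3 | l3
      · exact .inr (.inr (.inl ⟨l2, l3, K.s5 x l2 l3⟩))
      · exact .inr (.inr (.inr ⟨l3, K.s6 x l3 l4⟩))
    rcases e S with e1 | e1 | e1 | e1 <;> rcases e S' with e2 | e2 | e2 | e2 <;> clear e <;>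
      linarith
  · have e : ∀ {s : ℝ} {k : ℝ → ℝ}, Shape s (fun _ => 0) k →
        (x ≤ 19/30 - s/3 ∧ k x = 3/4 - 5 * (x - 5/8)) ∨
        (19/30 - s/3 ≤ x ∧ x ≤ 13/20 - s ∧ k x = 3/4 + 5/2 * (x - (13/20 - s))) ∨
        (13/20 - s ≤ x ∧ x ≤ 13/20 - 2*s/3 ∧ k x = 3/4 - 5 * (x - (13/20 - s))) ∨
        (13/20 - 2*s/3 ≤ x ∧ k x = 3/4 + 5/2 * (x - 13/20)) := by
      intro s k K
      rcases le_total x (19/30 - s/3) with l1 | l1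
      · exact .inl ⟨l1, K.s14 x l0 l1⟩
      rcases le_total x (13/20 - s) with l2 | l2
      · exact .inr (.inl ⟨l1, l2, K.s15 x l1 l2⟩)
      rcases le_total x (13/20 - 2*s/3) with l3 | l3
      · exact .inr (.inr (.inl ⟨l2, l3, K.s16 x l2 l3⟩))
      · exact .inr (.inr (.inr ⟨l3, K.s17 x l3 l4⟩))
    rcases e S with e1 | e1 | e1 | e1 <;> rcases e S' with e2 | e2 | e2 | e2 <;> clear e <;>
      linarith

theorem abs_sub_le (S : Shape t (fun _ => 0) g) (S' : Shape t' (fun _ => 0) g')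
    (ht : 0 < t) (ht' : t < 1/40) (hs : 0 < t') (hs' : t' < 1/40) (x : ℝ) :
    |g x - g' x| ≤ 10 * |t - t'| := by
  rw [← S.fract_eq, ← S'.fract_eq]
  have f0 := Int.fract_nonneg x
  have f1 := (Int.fract_lt_one x).le
  have d1 := le_abs_self (t - t')
  have d2 := neg_abs_le (t - t')
  have h1 := S.le_add_mul S' ht ht' hs hs' (d := |t - t'|) d1 (by linarith) f0 f1
  have h2 := S'.le_add_mul S hs hs' ht ht' (d := |t - t'|) (by linarith) d1 f0 f1
  exact abs_le.mpr ⟨by linarith, by linarith⟩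

/-- A point that is not a breakpoint has positive distance to the breakpoints of the limit, so for
large `n` it lies in the corresponding piece of `G n`, which has the same slope. -/
theorem eventually_deriv_eq {τ : ℕ → ℝ} {G : ℕ → ℝ → ℝ} (S : Shape t (fun _ => 0) g)
    (ht : 0 < t) (ht' : t < 1/40) (SG : ∀ n, Shape (τ n) (fun _ => 0) (G n))
    (hτ : Tendsto τ atTop (𝓝 t)) {x : ℝ} (h0 : 0 < x) (h1 : x < 1)
    (hx : x ∉ ({3/20, 3/20 + 2*t/3, 3/20 + t, 1/6 + t/3, 7/40, 5/8, 19/30 - t/3, 13/20 - t,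
      13/20 - 2*t/3, 13/20} : Set ℝ)) : ∀ᶠ n in atTop, deriv (G n) x = deriv g x := by
  simp only [Set.mem_insert_iff, Set.mem_singleton_iff, not_or] at hx
  obtain ⟨x0, x1, x2, x3, x4, x5, x6, x7, x8, x9⟩ := hx
  by_cases h : x < 3/20 ∨ (7/40 < x ∧ x < 5/8) ∨ 13/20 < x
  -- Off the zigzags the two functions agree near `x`, so `deriv` agrees even at a kink, where it is
  -- `0` by default. The other breakpoints thus need no exclusion.
  · refine Eventually.of_forall fun n => EventuallyEq.deriv_eq ?_
    have hopen : IsOpen {y : ℝ | (0 < y ∧ y < 1) ∧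
        (y < 3/20 ∨ (7/40 < y ∧ y < 5/8) ∨ 13/20 < y)} := by
      refine (isOpen_Ioo (a := (0 : ℝ)) (b := 1)).inter ((isOpen_Iio (a := (3/20 : ℝ))).union
        ((isOpen_Ioo (a := (7/40 : ℝ)) (b := 5/8)).union (isOpen_Ioi (a := (13/20 : ℝ)))))
    filter_upwards [hopen.mem_nhds ⟨⟨h0, h1⟩, h⟩] with y hy
    exact (S.eq_of_not_zigzag (SG n) ht ht' hy.1.1.le hy.1.2.le hy.2).symm
  have ev : ∀ {η : ℝ}, 0 < η → ∀ᶠ n in atTop, t - η < τ n ∧ τ n < t + η := fun hη =>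
    hτ.eventually (Ioo_mem_nhds (by linarith) (by linarith))
  have down {k : ℝ → ℝ} {a b v w : ℝ} (e : ∀ x, a ≤ x → x ≤ b → k x = v - 5 * (x - w))
      (ha : a < x) (hb : x < b) : deriv k x = -5 :=
    deriv_eq_of_affine (v := v) (w := w) (fun x h1 h2 => by rw [e x h1 h2]; ring) ha hb
  push Not at h
  have l0 := lt_of_le_of_ne h.1 (Ne.symm x0)
  rcases lt_or_ge (7/40) x with m | m
  · have m0 := lt_of_le_of_ne (h.2.1 m) (Ne.symm x5)
    have m4 := lt_of_le_of_ne h.2.2 x9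
    rcases lt_or_gt_of_ne x6 with m1 | m1
    · filter_upwards [ev (sub_pos.mpr m1)] with n hn
      rw [down S.s14 m0 m1, down (SG n).s14 m0 (by linarith)]
    rcases lt_or_gt_of_ne x7 with m2 | m2
    · filter_upwards [ev (sub_pos.mpr m1), ev (sub_pos.mpr m2)] with n hn hn'
      rw [deriv_eq_of_affine S.s15 m1 m2,
        deriv_eq_of_affine (SG n).s15 (by linarith) (by linarith)]
    rcases lt_or_gt_of_ne x8 with m3 | m3
    · filter_upwards [ev (sub_pos.mpr m2), ev (sub_pos.mpr m3)] with n hn hn'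
      rw [down S.s16 m2 m3, down (SG n).s16 (by linarith) (by linarith)]
    · filter_upwards [ev (sub_pos.mpr m3)] with n hn
      rw [deriv_eq_of_affine S.s17 m3 m4, deriv_eq_of_affine (SG n).s17 (by linarith) m4]
  · have m4 := lt_of_le_of_ne m x4
    rcases lt_or_gt_of_ne x1 with m1 | m1
    · filter_upwards [ev (sub_pos.mpr m1)] with n hn
      rw [deriv_eq_of_affine S.s3 l0 m1, deriv_eq_of_affine (SG n).s3 l0 (by linarith)]
    rcases lt_or_gt_of_ne x2 with m2 | m2
    · filter_upwards [ev (sub_pos.mpr m1), ev (sub_pos.mpr m2)] with n hn hn'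
      rw [down S.s4 m1 m2, down (SG n).s4 (by linarith) (by linarith)]
    rcases lt_or_gt_of_ne x3 with m3 | m3
    · filter_upwards [ev (sub_pos.mpr m2), ev (sub_pos.mpr m3)] with n hn hn'
      rw [deriv_eq_of_affine S.s5 m2 m3,
        deriv_eq_of_affine (SG n).s5 (by linarith) (by linarith)]
    · filter_upwards [ev (sub_pos.mpr m3)] with n hn
      rw [down S.s6 m3 m4, down (SG n).s6 (by linarith) m4]

theorem ae_tendsto_deriv {τ : ℕ → ℝ} {G : ℕ → ℝ → ℝ} (S : Shape t (fun _ => 0) g)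
    (ht : 0 < t) (ht' : t < 1/40) (SG : ∀ n, Shape (τ n) (fun _ => 0) (G n))
    (hτ : Tendsto τ atTop (𝓝 t)) :
    ∀ᵐ x, Tendsto (fun n => deriv (G n) x) atTop (𝓝 (deriv g x)) := by
  -- The point `0` is added to exclude the integers, since the previous lemma needs a fractional
  -- part inside `(0, 1)`.
  have hB : ({0, 3/20, 3/20 + 2*t/3, 3/20 + t, 1/6 + t/3, 7/40, 5/8, 19/30 - t/3, 13/20 - t,
      13/20 - 2*t/3, 13/20} : Set ℝ).Countable := (Set.toFinite _).countable
  filter_upwards [ae_fract_notMem hB] with x hx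
  rw [Set.mem_insert_iff, not_or] at hx
  refine tendsto_const_nhds.congr' ?_
  filter_upwards [S.eventually_deriv_eq ht ht' SG hτ
    (lt_of_le_of_ne (Int.fract_nonneg x) (Ne.symm hx.1)) (Int.fract_lt_one x) hx.2] with n hn
  rwa [deriv_fract_of_periodic (SG n).per, deriv_fract_of_periodic S.per, eq_comm] at hn

end Shape

/-- A sequence of irrational numbers in `(0, 1/40)` converging to `1/80`. -/
noncomputable def irrationalParam (n : ℕ) : ℝ := 1/80 + √2 / (400 * ((n : ℝ) + 1))

theorem irrationalParam_pos (n : ℕ) : 0 < irrationalParam n := by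
  unfold irrationalParam; positivity

theorem irrationalParam_lt (n : ℕ) : irrationalParam n < 1/40 := by
  have h2 : √2 < 2 := by
    rw [Real.sqrt_lt' (by norm_num)]; norm_num
  have : √2 / (400 * ((n : ℝ) + 1)) < 1/80 := by
    rw [div_lt_iff₀ (by positivity)]
    have : (0 : ℝ) ≤ n := n.cast_nonneg
    linarith
  unfold irrationalParam
  linarith

theorem irrational_irrationalParam (n : ℕ) : Irrational (irrationalParam n) := by
  have h := (irrational_sqrt_two.div_ratCast (q := 400 * ((n : ℚ) + 1)) (by positivity)).ratCast_add
    (1/80)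
  unfold irrationalParam
  convert h using 1
  push_cast
  ring

theorem tendsto_irrationalParam : Tendsto irrationalParam atTop (𝓝 (1/80)) := by
  have h := (tendsto_one_div_add_atTop_nhds_zero_nat (𝕜 := ℝ)).const_mul (√2 / 400)
  have h' := h.const_add (1/80)
  rw [mul_zero, add_zero] at h'
  refine h'.congr fun n => ?_
  unfold irrationalParam
  rw [div_mul_div_comm, mul_one]

end GroupRelax

open GroupRelax in
theorem mainTheorem5 :
    ∃ (f : ℝ) (π : ℕ → ℝ → ℝ) (ρ : ℝ → ℝ), 0 < f ∧ f < 1 ∧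
      (∀ n, GroupRelax.IsBHKIrrational f (π n) ∧ Continuous (π n) ∧
        GroupRelax.IsExtreme f (π n)) ∧
      (GroupRelax.IsBHKIrrational f ρ ∧ Continuous ρ ∧
        GroupRelax.IsValid f ρ ∧ ¬ GroupRelax.IsExtreme f ρ) ∧
      TendstoUniformly π ρ Filter.atTop ∧
      (∃ (π' : ℕ → ℝ → ℝ) (ρ' : ℝ → ℝ),
        (∀ n, GroupRelax.HasWeakDeriv (π n) (π' n)) ∧ GroupRelax.HasWeakDeriv ρ ρ' ∧
        GroupRelax.TendstoL1Loc π' ρ') ∧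
      GroupRelax.TendstoW11Loc π ρ := by
  have hp := irrationalParam_pos
  have hl := irrationalParam_lt
  have hr0 : (0 : ℝ) < 1/80 := by norm_num
  have hr1 : (1/80 : ℝ) < 1/40 := by norm_num
  have SG := fun n => toFun_shape (hp n) (hl n)
  have S := toFun_shape hr0 hr1
  have LG := fun n => (SG n).lipschitz (hp n) (hl n)
  have L := S.lipschitz hr0 hr1
  have hdist := fun n => (SG n).abs_sub_le S (hp n) (hl n) hr0 hr1
  have hdist0 : Tendsto (fun n => 10 * |irrationalParam n - 1/80|) atTop (𝓝 0) := by
    simpa using ((tendsto_irrationalParam.sub_const (1/80)).abs).const_mul 10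
  have hunif : TendstoUniformly (fun n => (zigzagParams (irrationalParam n)).toFun)
      (zigzagParams (1/80)).toFun atTop := by
    rw [Metric.tendstoUniformly_iff]
    intro ε hε
    filter_upwards [hdist0.eventually (gt_mem_nhds hε)] with n hn x
    rw [dist_comm, Real.dist_eq]
    exact (hdist n x).trans_lt hn
  have hWG := fun n => hasWeakDeriv_deriv_of_lipschitz (LG n)
  have hW := hasWeakDeriv_deriv_of_lipschitz L
  have hbd : ∀ {k : ℝ → ℝ}, LipschitzWith 5 k → ∀ x, |deriv k x| ≤ 5 := fun hk x => by
    simpa using norm_deriv_le_of_lipschitz hk (x₀ := x)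
  have hL1' : TendstoL1Loc (fun n => deriv (zigzagParams (irrationalParam n)).toFun)
      (deriv (zigzagParams (1/80)).toFun) :=
    tendstoL1Loc_of_dominated (C := 10) (fun n => (hWG n).2.1) hW.2.1
      (fun n x => (abs_sub _ _).trans (by linarith [hbd (LG n) x, hbd L x]))
      (S.ae_tendsto_deriv hr0 hr1 SG tendsto_irrationalParam)
  have hL1 : TendstoL1Loc (fun n => (zigzagParams (irrationalParam n)).toFun)
      (zigzagParams (1/80)).toFun :=
    tendstoL1Loc_of_dominated (C := 1) (fun n => (hWG n).1) hW.1
      (fun n x => (hdist n x).trans (by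
        have := abs_lt.mpr (⟨by linarith [hp n], by linarith [hl n]⟩ :
          -(1/10 : ℝ) < irrationalParam n - 1/80 ∧ irrationalParam n - 1/80 < 1/10)
        linarith))
      (Eventually.of_forall fun x => hunif.tendsto_at x)
  refine ⟨4/5, fun n => (zigzagParams (irrationalParam n)).toFun, (zigzagParams (1/80)).toFun,
    by norm_num, by norm_num, fun n => ⟨⟨_, zigzagParams_admissible (hp n) (hl n), rfl, rfl⟩,
      (LG n).continuous, (SG n).isExtreme (hp n) (hl n) (irrational_irrationalParam n)⟩,
    ⟨⟨_, zigzagParams_admissible hr0 hr1, rfl, rfl⟩, L.continuous,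
      S.isValid (isPerturbation_zero _) hr0 hr1, S.not_isExtreme⟩, hunif,
    ⟨_, _, hWG, hW, hL1'⟩, ⟨_, _, hWG, hW, hL1, hL1'⟩⟩
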